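/- Monadic second order (MSO) formulae about graphs are built from vertex variables $x,y,\dots$, variables $X,Y,\dots$ for sets of vertices, the atomic formulae $x\sim y$ (adjacency), $x=y$ and $X(x)$ (membership), the connectives $\neg,\wedge,\vee,\rightarrow,\leftrightarrow$, and the quantifiers $\forall,\exists$ over vertices and over sets of vertices. The quantifier depth $\mathrm{q}(\varphi)$ is the number of quantifiers (of both kinds) in a longest sequence of nested quantifiers of $\varphi$. For $\alpha>0$, let $G(n,n^{-\alpha})$ be the random graph on $n$ labelled vertices in which every pair of vertices is joined by an edge with probability $n^{-\alpha}$, independently of the other pairs. The spectrum $\mathcal S(\varphi)$ of an MSO sentence $\varphi$ is the set of all $\alpha>0$ for which it is not true that $\lim_{n\to\infty}\mathsf P(G(n,n^{-\alpha})\models\varphi)$ exists and equals $0$ or $1$. **Theorem.** There exists an MSO sentence $\varphi$ with $\mathrm{q}(\varphi)=4$ whose spectrum $\mathcal S(\varphi)$ is infinite; moreover, $\varphi$ can be chosen so that $$\frac12+\frac1{2(m+1)}\in\mathcal S(\varphi)\qquad\text{for every integer } m\ge 2 .$$ -/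

import Mathlib

open Filter Topology

/-- Monadic second order formulae in the language of graphs, with `k` free vertex variables
(indexed by `Fin k`) and `l` free set variables (indexed by `Fin l`). A quantifier binds the
variable with the last index. -/
inductive MSOFormula : ℕ → ℕ → Type
  /-- `x_i ∼ x_j` -/
  | adj {k l : ℕ} (i j : Fin k) : MSOFormula k l
  /-- `x_i = x_j` -/
  | eq {k l : ℕ} (i j : Fin k) : MSOFormula k l
  /-- `X_a(x_i)` -/
  | mem {k l : ℕ} (a : Fin l) (i : Fin k) : MSOFormula k l
  | not {k l : ℕ} (φ : MSOFormula k l) : MSOFormula k l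
  | and {k l : ℕ} (φ ψ : MSOFormula k l) : MSOFormula k l
  | or {k l : ℕ} (φ ψ : MSOFormula k l) : MSOFormula k l
  | imp {k l : ℕ} (φ ψ : MSOFormula k l) : MSOFormula k l
  | iff {k l : ℕ} (φ ψ : MSOFormula k l) : MSOFormula k l
  /-- universal quantifier over vertices -/
  | all {k l : ℕ} (φ : MSOFormula (k + 1) l) : MSOFormula k l
  /-- existential quantifier over vertices -/
  | ex {k l : ℕ} (φ : MSOFormula (k + 1) l) : MSOFormula k l
  /-- universal quantifier over sets of vertices -/
  | allSet {k l : ℕ} (φ : MSOFormula k (l + 1)) : MSOFormula k l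
  /-- existential quantifier over sets of vertices -/
  | exSet {k l : ℕ} (φ : MSOFormula k (l + 1)) : MSOFormula k l

namespace MSOFormula

/-- The quantifier depth: the largest number of nested quantifiers, over vertices or over sets. -/
def quantifierDepth : {k l : ℕ} → MSOFormula k l → ℕ
  | _, _, adj _ _ => 0
  | _, _, eq _ _ => 0
  | _, _, mem _ _ => 0
  | _, _, not φ => φ.quantifierDepth
  | _, _, and φ ψ => max φ.quantifierDepth ψ.quantifierDepth
  | _, _, or φ ψ => max φ.quantifierDepth ψ.quantifierDepth
  | _, _, imp φ ψ => max φ.quantifierDepth ψ.quantifierDepth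
  | _, _, iff φ ψ => max φ.quantifierDepth ψ.quantifierDepth
  | _, _, all φ => φ.quantifierDepth + 1
  | _, _, ex φ => φ.quantifierDepth + 1
  | _, _, allSet φ => φ.quantifierDepth + 1
  | _, _, exSet φ => φ.quantifierDepth + 1

/-- Truth of a formula in the graph `G`, where `x` interprets the free vertex variables and `X`
the free set variables. -/
def Realize {V : Type*} (G : SimpleGraph V) :
    {k l : ℕ} → MSOFormula k l → (Fin k → V) → (Fin l → Set V) → Prop
  | _, _, adj i j, x, _ => G.Adj (x i) (x j)
  | _, _, eq i j, x, _ => x i = x j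
  | _, _, mem a i, x, X => x i ∈ X a
  | _, _, not φ, x, X => ¬ φ.Realize G x X
  | _, _, and φ ψ, x, X => φ.Realize G x X ∧ ψ.Realize G x X
  | _, _, or φ ψ, x, X => φ.Realize G x X ∨ ψ.Realize G x X
  | _, _, imp φ ψ, x, X => φ.Realize G x X → ψ.Realize G x X
  | _, _, iff φ ψ, x, X => φ.Realize G x X ↔ ψ.Realize G x X
  | _, _, all φ, x, X => ∀ v : V, φ.Realize G (Fin.snoc (α := fun _ => V) x v) X
  | _, _, ex φ, x, X => ∃ v : V, φ.Realize G (Fin.snoc (α := fun _ => V) x v) X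
  | _, _, allSet φ, x, X => ∀ S : Set V, φ.Realize G x (Fin.snoc (α := fun _ => Set V) X S)
  | _, _, exSet φ, x, X => ∃ S : Set V, φ.Realize G x (Fin.snoc (α := fun _ => Set V) X S)

end MSOFormula

/-- MSO sentences: formulae without free variables. -/
abbrev MSOSentence : Type := MSOFormula 0 0

/-- `G ⊨ φ` for an MSO sentence `φ`. -/
def SimpleGraph.Models {V : Type*} (G : SimpleGraph V) (φ : MSOSentence) : Prop :=
  φ.Realize G Fin.elim0 Fin.elim0

/-- The edge probability `n ^ (-α)`, as an element of `[0, 1]`. -/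
noncomputable def edgeProb (α : ℝ) (n : ℕ) : unitInterval :=
  Set.projIcc (0 : ℝ) 1 zero_le_one ((n : ℝ) ^ (-α))

/-- For `α > 0` the truncation in `edgeProb` does nothing. -/
theorem coe_edgeProb {α : ℝ} (hα : 0 < α) (n : ℕ) : (edgeProb α n : ℝ) = (n : ℝ) ^ (-α) := by
  have h0 : (0 : ℝ) ≤ (n : ℝ) ^ (-α) := Real.rpow_nonneg (Nat.cast_nonneg n) _
  have h1 : (n : ℝ) ^ (-α) ≤ 1 := by
    rcases Nat.eq_zero_or_pos n with rfl | hn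
    · rw [Nat.cast_zero, Real.zero_rpow (by linarith)]
      exact zero_le_one
    · exact Real.rpow_le_one_of_one_le_of_nonpos (by exact_mod_cast hn) (by linarith)
  rw [edgeProb, Set.projIcc_of_mem zero_le_one ⟨h0, h1⟩]

/-- The probability that the binomial random graph `G(n, n ^ (-α))` satisfies `φ`. -/
noncomputable def MSOFormula.prob (φ : MSOSentence) (α : ℝ) (n : ℕ) : ℝ :=
  (SimpleGraph.binomialRandom (Fin n) (edgeProb α n)).real {G | G.Models φ}

/-- The spectrum of `φ`: all `α > 0` for which it is not the case that the limit of
`P(G(n, n ^ (-α)) ⊨ φ)` exists and equals `0` or `1`. -/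
def MSOFormula.spectrum (φ : MSOSentence) : Set ℝ :=
  {α | 0 < α ∧ ¬ (Tendsto (φ.prob α) atTop (𝓝 0) ∨ Tendsto (φ.prob α) atTop (𝓝 1))}

/-!
A set satisfying `IsFanSet` is covered by a common neighbour `y`, has a dominating element `x`, and
contains a triangle, so a set of at least `k + 3` vertices of this kind yields a copy of `fan k`:
the hubs `y` and `x`, together with the `k + 2` remaining vertices. This graph has `k + 4` vertices
and `2 (k + 3)` edges, so for `p = n ^ (-α)` with `α = 1 / 2 + 1 / (2 (m + 1))` and `m = k + 2` the
quantity `n ^ (k + 4) * p ^ (2 (k + 3))` is exactly `1`: the copies of the fan are at their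
threshold.

Upper bound. Every set `X` with `2 ≤ |X| ≤ m` is centered, up to an exponentially small
probability: after exposing the pairs that meet `X`, each `u ∈ X` has about `p n` neighbours of its
own, and an outside vertex adjacent to one of them for every `u ∈ X`, but to no common neighbour of
`X`, still appears with probability of order `(p ^ 2 n) ^ |X|`, while `n (p ^ 2 n) ^ m` is a power
of `n` with positive exponent. Larger fan sets contain a copy of the fan. Exchanging the hubs turns
one copy into another, so copies come in pairs and exist with probability at most `1 / 2`.

Lower bound. By Harris' inequality, a given set of `k + 3` vertices has no detour with probability
bounded below, independently of the edges of a given copy, and a copy without detour refutes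
centeredness. The second moment method then produces such a copy with probability bounded below.
-/

namespace RandomGraph

open MeasureTheory ProbabilityTheory SimpleGraph

/-- `X` has a common neighbour, has an element adjacent to all its other elements, and contains a
triangle. -/
def IsFanSet {V : Type*} (G : SimpleGraph V) (X : Set V) : Prop :=
  (∃ y, ∀ u, u ∈ X → G.Adj y u) ∧ (∃ x, x ∈ X ∧ ∀ u, u ∈ X → (u = x ∨ G.Adj x u)) ∧
    ∃ a b c, a ∈ X ∧ b ∈ X ∧ c ∈ X ∧ G.Adj a b ∧ G.Adj a c ∧ G.Adj b c

/-- Some vertex `v`, none of whose neighbours is adjacent to all of `X`, has a common neighbour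
outside `X` with every element of `X`. -/
def IsCentered {V : Type*} (G : SimpleGraph V) (X : Set V) : Prop :=
  ∃ v, (∀ u, u ∈ X → ∃ w, w ∉ X ∧ G.Adj w u ∧ G.Adj w v) ∧
    ¬ ∃ w, G.Adj w v ∧ ∀ u, u ∈ X → G.Adj w u

/-- The MSO sentence stating that some set satisfies `IsFanSet` but not `IsCentered`. -/
def fanSentence : MSOSentence :=
  .exSet (.and
    (.and (.ex (.all (.imp (.mem 0 1) (.adj 0 1))))
      (.and (.ex (.and (.mem 0 0) (.all (.imp (.mem 0 1) (.or (.eq 1 0) (.adj 0 1))))))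
        (.ex (.ex (.ex (.and (.mem 0 0) (.and (.mem 0 1) (.and (.mem 0 2)
          (.and (.adj 0 1) (.and (.adj 0 2) (.adj 1 2)))))))))))
    (.not (.ex (.and
      (.all (.imp (.mem 0 1) (.ex (.and (.not (.mem 0 2)) (.and (.adj 2 1) (.adj 2 0))))))
      (.not (.ex (.and (.adj 1 0) (.all (.imp (.mem 0 2) (.adj 1 2))))))))))

theorem quantifierDepth_fanSentence : fanSentence.quantifierDepth = 4 := by
  simp [fanSentence, MSOFormula.quantifierDepth]

theorem models_fanSentence {V : Type*} (G : SimpleGraph V) :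
    G.Models fanSentence ↔ ∃ X : Set V, IsFanSet G X ∧ ¬ IsCentered G X := by
  simp [SimpleGraph.Models, fanSentence, MSOFormula.Realize, IsFanSet, IsCentered, Fin.snoc]

section Independence

variable {V : Type*} {p : unitInterval}

instance [Finite V] : DiscreteMeasurableSpace (SimpleGraph V) where
  forall_measurableSet s := by
    rw [← s.preimage_image_eq edgeSet_injective]
    exact measurable_edgeSet (Set.toFinite _).measurableSet

theorem isSetBernoulli_edgeSet [Countable V] :
    IsSetBernoulli (edgeSet : SimpleGraph V → Set (Sym2 V)) Sym2.diagSetᶜ p G(V, p) where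
  aemeasurable := measurable_edgeSet.aemeasurable
  map_eq := by
    rw [binomialRandom_eq_map, Measure.map_map measurable_edgeSet measurable_fromEdgeSet]
    refine (Measure.map_congr ?_).trans Measure.map_id
    filter_upwards [setBernoulli_ae_subset] with s hs
    simpa [Set.subset_compl_iff_disjoint_right] using hs

/-- The law of the indicator of `e` being an edge of the binomial random graph. -/
noncomputable def edgeLaw (p : unitInterval) (e : Sym2 V) : Measure Prop :=
  unitInterval.toNNReal p • .dirac (e ∈ Sym2.diagSetᶜ) +
    unitInterval.toNNReal (unitInterval.symm p) • .dirac False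

instance (e : Sym2 V) : IsProbabilityMeasure (edgeLaw p e) := by
  unfold edgeLaw
  infer_instance

theorem hasLaw_mem_edgeSet_pi [Countable V] :
    HasLaw (fun (G : SimpleGraph V) e ↦ e ∈ G.edgeSet) (Measure.infinitePi (edgeLaw p))
      G(V, p) := by
  refine HasLaw.comp (Y := fun s e ↦ e ∈ s) ⟨by fun_prop, ?_⟩ isSetBernoulli_edgeSet
  rw [setBernoulli_eq_map, Measure.map_map (by fun_prop) (by fun_prop)]
  exact Measure.map_id

theorem hasLaw_mem_edgeSet [Countable V] (e : Sym2 V) :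
    HasLaw (fun G : SimpleGraph V ↦ e ∈ G.edgeSet) (edgeLaw p e) G(V, p) :=
  (measurePreserving_eval_infinitePi _ e).hasLaw.comp hasLaw_mem_edgeSet_pi

theorem iIndepFun_mem_edgeSet [Countable V] :
    iIndepFun (fun (e : Sym2 V) (G : SimpleGraph V) ↦ e ∈ G.edgeSet) G(V, p) :=
  (iIndepFun_iff_hasLaw_Pi_infinitePi hasLaw_mem_edgeSet
    hasLaw_mem_edgeSet_pi.aemeasurable).2 hasLaw_mem_edgeSet_pi

theorem measureReal_mem_edgeSet [Countable V] {e : Sym2 V} (he : ¬ e.IsDiag) :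
    G(V, p).real {G | e ∈ G.edgeSet} = p := by
  rw [(hasLaw_mem_edgeSet e).measureReal_eq (p := fun q ↦ q) (by measurability)]
  simp [edgeLaw, measureReal_def, he]

/-- Whether a graph belongs to `𝓔` is decided by which of the pairs in `A` are its edges. -/
def DependsOnPairs (𝓔 : Set (SimpleGraph V)) (A : Set (Sym2 V)) : Prop :=
  ∀ ⦃G H : SimpleGraph V⦄, G.edgeSet ∩ A = H.edgeSet ∩ A → G ∈ 𝓔 → H ∈ 𝓔

variable {𝓔 𝓕 : Set (SimpleGraph V)} {A B : Set (Sym2 V)}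

theorem DependsOnPairs.mono (h : DependsOnPairs 𝓔 A) (hAB : A ⊆ B) : DependsOnPairs 𝓔 B :=
  fun G H hGH ↦ h (by
    rw [← Set.inter_eq_right.2 hAB, ← Set.inter_assoc, ← Set.inter_assoc, hGH])

theorem DependsOnPairs.compl (h : DependsOnPairs 𝓔 A) : DependsOnPairs 𝓔ᶜ A :=
  fun _ _ hGH hG hH ↦ hG (h hGH.symm hH)

theorem DependsOnPairs.indepSet [Finite V] (h𝓔 : DependsOnPairs 𝓔 A) (h𝓕 : DependsOnPairs 𝓕 B)
    (hAB : Disjoint A B) : IndepSet 𝓔 𝓕 G(V, p) := by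
  have key : ∀ {𝓔 : Set (SimpleGraph V)} {A : Set (Sym2 V)}, DependsOnPairs 𝓔 A →
      ∃ T : Set (A.toFinite.toFinset → Prop),
        𝓔 = (fun (G : SimpleGraph V) (e : A.toFinite.toFinset) ↦ e.1 ∈ G.edgeSet) ⁻¹' T := by
    refine fun {𝓔 A} h ↦
      ⟨(fun G e ↦ e.1 ∈ G.edgeSet) '' 𝓔, (Set.subset_preimage_image _ _).antisymm ?_⟩
    rintro G ⟨H, hH, hHG⟩
    refine h (Set.ext fun e ↦ and_congr_left fun he ↦ ?_) hH
    exact iff_of_eq (congrFun hHG ⟨e, A.toFinite.mem_toFinset.2 he⟩)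
  obtain ⟨S, rfl⟩ := key h𝓔
  obtain ⟨T, rfl⟩ := key h𝓕
  have hind := iIndepFun_mem_edgeSet (p := p).indepFun_finset A.toFinite.toFinset
    B.toFinite.toFinset (by simpa) fun _ ↦ .of_discrete
  exact (indepFun_iff_indepSet_preimage .of_discrete .of_discrete).1 hind S T
    S.toFinite.measurableSet T.toFinite.measurableSet

theorem DependsOnPairs.biInter {ι : Type*} {s : Finset ι} {𝓔 : ι → Set (SimpleGraph V)}
    (h : ∀ i ∈ s, DependsOnPairs (𝓔 i) A) : DependsOnPairs (⋂ i ∈ s, 𝓔 i) A :=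
  fun _ _ hGH hG ↦ Set.mem_iInter₂.2 fun i hi ↦ h i hi hGH (Set.mem_iInter₂.1 hG i hi)

theorem iIndepSet_of_dependsOnPairs [Finite V] {ι : Type*} {𝓔 : ι → Set (SimpleGraph V)}
    {A : ι → Set (Sym2 V)} (h : ∀ i, DependsOnPairs (𝓔 i) (A i))
    (hA : Pairwise (Function.onFun Disjoint A)) : iIndepSet 𝓔 G(V, p) := by
  classical
  refine (iIndepSet_iff_meas_biInter fun _ ↦ .of_discrete).2 fun s ↦ ?_
  induction s using Finset.induction_on with
  | empty => simp
  | insert i s hi ih =>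
    have hind : IndepSet (𝓔 i) (⋂ j ∈ s, 𝓔 j) G(V, p) :=
      (h i).indepSet (B := ⋃ j ∈ s, A j)
        (.biInter fun j hj ↦ (h j).mono (Set.subset_biUnion_of_mem (Finset.mem_coe.2 hj)))
        (Set.disjoint_iUnion₂_right.2 fun j hj ↦ hA fun hij ↦ hi (hij ▸ hj))
    rw [Finset.set_biInter_insert, hind.measure_inter_eq_mul, ih, Finset.prod_insert hi]

theorem measureReal_biInter_of_iIndepSet {Ω ι : Type*} [MeasurableSpace Ω] {μ : Measure Ω}
    {S : ι → Set Ω} (h : iIndepSet S μ) (s : Finset ι) :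
    μ.real (⋂ i ∈ s, S i) = ∏ i ∈ s, μ.real (S i) := by
  simp [measureReal_def, h.meas_biInter, ENNReal.toReal_prod]

theorem dependsOnPairs_mem_edgeSet (e : Sym2 V) :
    DependsOnPairs {G | e ∈ G.edgeSet} {e} :=
  fun _ _ hGH hG ↦ ((Set.ext_iff.1 hGH e).1 ⟨hG, rfl⟩).1

theorem dependsOnPairs_ge (H : SimpleGraph V) : DependsOnPairs {G | H ≤ G} H.edgeSet := by
  intro G G' hGG' hG
  have hG : H.edgeSet ⊆ G.edgeSet := edgeSet_subset_edgeSet.2 hG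
  rw [Set.inter_eq_right.2 hG] at hGG'
  exact edgeSet_subset_edgeSet.1 (Set.inter_eq_right.1 hGG'.symm)

theorem measureReal_ge [Finite V] (H : SimpleGraph V) :
    G(V, p).real {G | H ≤ G} = (p : ℝ) ^ H.edgeSet.ncard := by
  have hinter := measureReal_biInter_of_iIndepSet (iIndepSet_of_dependsOnPairs (p := p)
    dependsOnPairs_mem_edgeSet fun _ _ h ↦ Set.disjoint_singleton.2 h) H.edgeSet.toFinite.toFinset
  have hprod := Finset.prod_congr (g := fun _ ↦ (p : ℝ)) rfl fun e he ↦
    measureReal_mem_edgeSet (p := p)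
      (H.not_isDiag_of_mem_edgeSet (H.edgeSet.toFinite.mem_toFinset.1 he))
  rw [hprod, Finset.prod_const, ← Set.ncard_eq_toFinset_card] at hinter
  rw [← hinter]
  congr 1
  ext G
  simp only [Set.mem_iInter, Set.Finite.mem_toFinset, Set.mem_ofPred_eq]
  exact edgeSet_subset_edgeSet.symm

theorem iIndepSet_adj [Finite V] (v : V) : iIndepSet (fun w ↦ {G | G.Adj v w}) G(V, p) :=
  iIndepSet_of_dependsOnPairs (fun w ↦ dependsOnPairs_mem_edgeSet s(v, w)) fun _ _ h ↦
    Set.disjoint_singleton.2 fun h' ↦ h (Sym2.congr_right.1 h')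

theorem measureReal_forall_not_adj [Finite V] {v : V} {B : Finset V} (hv : v ∉ B) :
    G(V, p).real {G | ∀ w ∈ B, ¬ G.Adj v w} = (1 - (p : ℝ)) ^ B.card := by
  have hinter := measureReal_biInter_of_iIndepSet (iIndepSet_of_dependsOnPairs (p := p)
    (fun w ↦ (dependsOnPairs_mem_edgeSet s(v, w)).compl) fun _ _ h ↦
      Set.disjoint_singleton.2 fun h' ↦ h (Sym2.congr_right.1 h')) B
  have hprod : ∀ w ∈ B, G(V, p).real {G | s(v, w) ∈ G.edgeSet}ᶜ = 1 - p := fun w hw ↦ by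
    rw [probReal_compl_eq_one_sub .of_discrete,
      measureReal_mem_edgeSet (by simpa using fun h : v = w ↦ hv (h ▸ hw))]
  rw [Finset.prod_congr rfl hprod, Finset.prod_const] at hinter
  rw [← hinter]
  congr 1
  ext G
  simp

/-- Exposing the pairs outside `A` first: a bound for the probability of an event depending only on
`A`, valid for every outcome of the first round, holds without conditioning. -/
theorem measureReal_mem_deleteEdges_le [Finite V] {𝓔 : SimpleGraph V → Set (SimpleGraph V)}
    (h𝓔 : ∀ H, DependsOnPairs (𝓔 H) A) {δ : ℝ} (hδ : ∀ H, G(V, p).real (𝓔 H) ≤ δ) :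
    G(V, p).real {G | G ∈ 𝓔 (G.deleteEdges A)} ≤ δ := by
  classical
  have := Fintype.ofFinite (SimpleGraph V)
  let first (H : SimpleGraph V) : Set (SimpleGraph V) := (fun G ↦ G.deleteEdges A) ⁻¹' {H}
  have hfirst : ∀ H, DependsOnPairs (first H) Aᶜ := by
    rintro _ G G' hGG' rfl
    simpa [first, ← edgeSet_inj, Set.sdiff_eq] using hGG'.symm
  have hsum : ∑ H, G(V, p).real (first H) = 1 := by
    simpa using sum_measureReal_preimage_singleton (μ := G(V, p)) Finset.univ
      (f := fun G : SimpleGraph V ↦ G.deleteEdges A) fun _ _ ↦ .of_discrete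
  calc G(V, p).real {G | G ∈ 𝓔 (G.deleteEdges A)}
      = G(V, p).real (⋃ H, first H ∩ 𝓔 H) := by congr 1; ext G; simp [first]
    _ ≤ ∑ H, G(V, p).real (first H ∩ 𝓔 H) := measureReal_iUnion_fintype_le _
    _ = ∑ H, G(V, p).real (first H) * G(V, p).real (𝓔 H) := by
        refine Finset.sum_congr rfl fun H _ ↦ ?_
        simp [measureReal_def, ← ENNReal.toReal_mul,
          ((hfirst H).indepSet (h𝓔 H) disjoint_compl_left).measure_inter_eq_mul]
    _ ≤ ∑ H, G(V, p).real (first H) * δ := by gcongr; exact hδ _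
    _ = δ := by rw [← Finset.sum_mul, hsum, one_mul]

end Independence

section Concentration

open Real

variable {Ω ι : Type*} [Fintype ι] {S : ι → Set Ω}

theorem sum_indicator_eq_ncard (S : ι → Set Ω) (ω : Ω) :
    (∑ i, (S i).indicator 1) ω = ({i | ω ∈ S i}.ncard : ℝ) := by
  classical
  simp [Set.indicator_apply, Set.ncard_eq_toFinset_card']

theorem sum_indicator_sq (S : ι → Set Ω) (ω : Ω) :
    (∑ i, (S i).indicator (1 : Ω → ℝ)) ω ^ 2 =
      (∑ i, ∑ j, (S i ∩ S j).indicator (1 : Ω → ℝ)) ω := by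
  simp only [Finset.sum_apply, sq, Finset.sum_mul_sum, Set.inter_indicator_one, Pi.mul_apply]

variable [MeasurableSpace Ω] {μ : Measure Ω}

theorem mgf_indicator [IsProbabilityMeasure μ] {T : Set Ω} (hT : MeasurableSet T) (t : ℝ) :
    mgf (T.indicator 1) μ t = 1 + (exp t - 1) * μ.real T := by
  have h : ∀ ω, exp (t * T.indicator 1 ω) = 1 + (exp t - 1) * T.indicator 1 ω := by
    intro ω
    by_cases hω : ω ∈ T <;> simp [hω]
  simp_rw [mgf, h]
  rw [integral_add (integrable_const _) (((integrable_const 1).indicator hT).const_mul _),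
    integral_const_mul, integral_indicator_one hT]
  simp

theorem mgf_sum_indicator_le (h : iIndepSet S μ) (hS : ∀ i, MeasurableSet (S i)) (t : ℝ) :
    mgf (∑ i, (S i).indicator 1) μ t ≤ exp ((exp t - 1) * ∑ i, μ.real (S i)) := by
  have := h.isProbabilityMeasure
  have hind : iIndepFun (fun i ↦ (S i).indicator (1 : Ω → ℝ)) μ := h.iIndepFun_indicator
  rw [hind.mgf_sum fun i ↦ measurable_one.indicator (hS i), Finset.mul_sum, exp_sum]
  refine Finset.prod_le_prod (fun _ _ ↦ mgf_nonneg) fun i _ ↦ ?_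
  rw [mgf_indicator (hS i), add_comm]
  exact add_one_le_exp _

theorem integrable_exp_mul_sum_indicator [IsProbabilityMeasure μ]
    (hS : ∀ i, MeasurableSet (S i)) (t : ℝ) :
    Integrable (fun ω ↦ exp (t * (∑ i, (S i).indicator 1) ω)) μ := by
  have hm : Measurable fun ω ↦ (∑ i, (S i).indicator (1 : Ω → ℝ)) ω := by
    simp only [Finset.sum_apply]
    exact Finset.measurable_sum _ fun i _ ↦ measurable_one.indicator (hS i)
  refine .of_bound (by fun_prop) (exp (|t| * Fintype.card ι)) (.of_forall fun ω ↦ ?_)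
  rw [norm_of_nonneg (exp_nonneg _), exp_le_exp, sum_indicator_eq_ncard]
  have : ({i | ω ∈ S i}.ncard : ℝ) ≤ Fintype.card ι := by
    exact_mod_cast Nat.card_eq_fintype_card (α := ι) ▸ Set.ncard_le_card _
  gcongr
  exact le_abs_self t

theorem measureReal_ncard_le_le (h : iIndepSet S μ) (hS : ∀ i, MeasurableSet (S i)) {q : ℝ}
    (hq0 : 0 ≤ q) (hq : ∀ i, q ≤ μ.real (S i)) :
    μ.real {ω | ({i | ω ∈ S i}.ncard : ℝ) ≤ q * Fintype.card ι / 4} ≤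
      exp (-(q * Fintype.card ι) / 4) := by
  have := h.isProbabilityMeasure
  have hsum : q * Fintype.card ι ≤ ∑ i, μ.real (S i) := by
    simpa [mul_comm] using Finset.sum_le_sum fun i (_ : i ∈ Finset.univ) ↦ hq i
  have hexp : exp (-1) ≤ 1 / 2 := by linarith [exp_neg_one_lt_half]
  simp_rw [← sum_indicator_eq_ncard]
  refine (measure_le_le_exp_mul_mgf _ (t := -1) (by norm_num)
    (integrable_exp_mul_sum_indicator hS _)).trans ?_
  refine (mul_le_mul_of_nonneg_left (mgf_sum_indicator_le h hS _) (exp_nonneg _)).trans ?_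
  rw [← exp_add, exp_le_exp]
  have : 0 ≤ q * Fintype.card ι := by positivity
  nlinarith

theorem measureReal_le_ncard_le (h : iIndepSet S μ) (hS : ∀ i, MeasurableSet (S i)) {q : ℝ}
    (hq : ∀ i, μ.real (S i) ≤ q) (ε : ℝ) :
    μ.real {ω | ε ≤ ({i | ω ∈ S i}.ncard : ℝ)} ≤ exp (2 * (q * Fintype.card ι) - ε) := by
  have := h.isProbabilityMeasure
  have hsum : ∑ i, μ.real (S i) ≤ q * Fintype.card ι := by
    simpa [mul_comm] using Finset.sum_le_sum fun i (_ : i ∈ Finset.univ) ↦ hq i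
  have hexp : exp 1 - 1 ≤ 2 := by linarith [exp_one_lt_d9]
  simp_rw [← sum_indicator_eq_ncard]
  refine (measure_ge_le_exp_mul_mgf ε zero_le_one
    (integrable_exp_mul_sum_indicator hS _)).trans ?_
  refine (mul_le_mul_of_nonneg_left (mgf_sum_indicator_le h hS _) (exp_nonneg _)).trans ?_
  rw [← exp_add, exp_le_exp]
  have : 0 ≤ ∑ i, μ.real (S i) := by positivity
  nlinarith

theorem integrable_indicator [IsProbabilityMeasure μ] {T : Set Ω} (hT : MeasurableSet T) :
    Integrable (T.indicator (1 : Ω → ℝ)) μ :=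
  (integrable_const 1).indicator hT

theorem sq_div_le_measureReal_iUnion [IsProbabilityMeasure μ] (hS : ∀ i, MeasurableSet (S i))
    {c C : ℝ} (hc : 0 ≤ c) (hC : 0 < C) (hcS : c ≤ ∑ i, μ.real (S i))
    (hCS : ∑ i, ∑ j, μ.real (S i ∩ S j) ≤ C) : c ^ 2 / C ≤ μ.real (⋃ i, S i) := by
  let Z : Ω → ℝ := ∑ i, (S i).indicator 1
  have hint1 : Integrable Z μ := integrable_finsetSum' _ fun i _ ↦ integrable_indicator (hS i)
  have hint2 : Integrable (fun ω ↦ Z ω ^ 2) μ := by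
    simp_rw [Z, sum_indicator_sq]
    exact integrable_finsetSum' _ fun i _ ↦ integrable_finsetSum' _ fun j _ ↦
      integrable_indicator ((hS i).inter (hS j))
  have hEZ : ∫ ω, Z ω ∂μ = ∑ i, μ.real (S i) := by
    simp_rw [Z, Finset.sum_apply]
    rw [integral_finsetSum _ fun i _ ↦ integrable_indicator (hS i)]
    simp_rw [integral_indicator_one (hS _)]
  have hEZ2 : ∫ ω, Z ω ^ 2 ∂μ = ∑ i, ∑ j, μ.real (S i ∩ S j) := by
    simp_rw [Z, sum_indicator_sq, Finset.sum_apply]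
    rw [integral_finsetSum _ fun i _ ↦ integrable_finsetSum _ fun j _ ↦
      integrable_indicator ((hS i).inter (hS j))]
    simp_rw [integral_finsetSum _ fun j _ ↦ integrable_indicator ((hS _).inter (hS j)),
      integral_indicator_one ((hS _).inter (hS _))]
  have hpt : ∀ ω, 2 * (c / C) * Z ω - (c / C) ^ 2 * Z ω ^ 2 ≤ (⋃ i, S i).indicator 1 ω := by
    intro ω
    by_cases hω : ω ∈ ⋃ i, S i
    · simpa [hω] using by nlinarith [sq_nonneg (1 - c / C * Z ω)]
    · have hZ : Z ω = 0 := by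
        simpa [Z] using Finset.sum_eq_zero fun i (_ : i ∈ Finset.univ) ↦
          Set.indicator_of_notMem (fun h ↦ hω (Set.mem_iUnion_of_mem i h)) (1 : Ω → ℝ)
      simp [hω, hZ]
  have hint := integral_mono ((hint1.const_mul _).sub (hint2.const_mul _))
    (integrable_indicator (.iUnion hS)) hpt
  rw [integral_sub' (hint1.const_mul _) (hint2.const_mul _), integral_const_mul,
    integral_const_mul, hEZ, hEZ2, integral_indicator_one (.iUnion hS)] at hint
  calc c ^ 2 / C = 2 * (c / C) * c - (c / C) ^ 2 * C := by field_simp; ring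
    _ ≤ 2 * (c / C) * ∑ i, μ.real (S i) - (c / C) ^ 2 * ∑ i, ∑ j, μ.real (S i ∩ S j) := by gcongr
    _ ≤ _ := hint

theorem two_mul_measureReal_iUnion_le [IsProbabilityMeasure μ] (hS : ∀ i, MeasurableSet (S i))
    {τ : ι → ι} (hτ : ∀ i, τ i ≠ i) (hSτ : ∀ i, S i ⊆ S (τ i)) :
    2 * μ.real (⋃ i, S i) ≤ ∑ i, μ.real (S i) := by
  classical
  have hpt : ∀ ω, 2 * (⋃ i, S i).indicator 1 ω ≤ ∑ i, (S i).indicator (1 : Ω → ℝ) ω := by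
    intro ω
    by_cases hω : ω ∈ ⋃ i, S i
    · obtain ⟨i, hi⟩ := Set.mem_iUnion.1 hω
      calc (2 : ℝ) * (⋃ i, S i).indicator 1 ω
          = ∑ j ∈ {τ i, i}, (S j).indicator (1 : Ω → ℝ) ω := by
            rw [Finset.sum_pair (hτ i)]
            simp [hω, hi, hSτ i hi, one_add_one_eq_two]
        _ ≤ ∑ j, (S j).indicator (1 : Ω → ℝ) ω :=
            Finset.sum_le_sum_of_subset_of_nonneg (Finset.subset_univ _) fun j _ _ ↦
              Set.indicator_nonneg (fun _ _ ↦ zero_le_one) ω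
    · simpa [hω] using Finset.sum_nonneg fun j _ ↦
        Set.indicator_nonneg (s := S j) (f := (1 : Ω → ℝ)) (fun _ _ ↦ zero_le_one) ω
  have hint := integral_mono ((integrable_indicator (μ := μ) (.iUnion hS)).const_mul 2)
    (integrable_finsetSum _ fun i _ ↦ integrable_indicator (hS i)) hpt
  rw [integral_const_mul, integral_indicator_one (.iUnion hS),
    integral_finsetSum _ fun i _ ↦ integrable_indicator (hS i)] at hint
  simpa only [integral_indicator_one (hS _)] using hint

end Concentration

section Harris

variable {V : Type*} [Finite V] {p : unitInterval}

theorem measureReal_singleton_mul_le (G H : SimpleGraph V) :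
    G(V, p).real {G} * G(V, p).real {H} ≤ G(V, p).real {G ⊓ H} * G(V, p).real {G ⊔ H} := by
  classical
  have := Fintype.ofFinite V
  have hle : ∀ G : SimpleGraph V, G.edgeSet.ncard ≤ (Fintype.card V).choose 2 := fun G ↦ by
    rw [← coe_edgeFinset, Set.ncard_coe_finset]
    exact card_edgeFinset_le_card_choose_two
  have hcard := Set.ncard_inter_add_ncard_union G.edgeSet H.edgeSet
  rw [← edgeSet_inf, ← edgeSet_sup] at hcard
  have hcompl : ∀ a b c d N : ℕ, a ≤ N → b ≤ N → c ≤ N → d ≤ N → c + d = a + b →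
      (N - a) + (N - b) = (N - c) + (N - d) := by omega
  refine le_of_eq ?_
  simp only [measureReal_def, binomialRandom_singleton, ENNReal.toReal_mul, ENNReal.toReal_pow,
    Nat.card_eq_fintype_card]
  rw [mul_mul_mul_comm, ← pow_add, ← pow_add, mul_mul_mul_comm, ← pow_add, ← pow_add, hcard,
    hcompl _ _ _ _ _ (hle G) (hle H) (hle _) (hle _) hcard]

theorem measureReal_mul_le_of_isUpperSet {𝓔 𝓕 : Set (SimpleGraph V)} (h𝓔 : IsUpperSet 𝓔)
    (h𝓕 : IsUpperSet 𝓕) :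
    G(V, p).real 𝓔 * G(V, p).real 𝓕 ≤ G(V, p).real (𝓔 ∩ 𝓕) := by
  classical
  have := Fintype.ofFinite V
  have hmono : ∀ {𝓤 : Set (SimpleGraph V)}, IsUpperSet 𝓤 →
      Monotone (𝓤.indicator fun _ ↦ (1 : ℝ)) := fun {𝓤} h G H hGH ↦ by
    by_cases hG : G ∈ 𝓤
    · simp [hG, h hGH hG]
    · simpa [hG] using Set.indicator_nonneg (fun _ _ ↦ zero_le_one) H
  have hreal : ∀ 𝓤 : Set (SimpleGraph V),
      ∑ G, G(V, p).real {G} * 𝓤.indicator (fun _ ↦ 1) G = G(V, p).real 𝓤 := fun 𝓤 ↦ by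
    simp [Set.indicator_apply, ← Finset.sum_filter, sum_measureReal_singleton]
  have hinter : ∀ G, 𝓔.indicator (fun _ ↦ (1 : ℝ)) G * 𝓕.indicator (fun _ ↦ 1) G =
      (𝓔 ∩ 𝓕).indicator (fun _ ↦ 1) G := fun G ↦ by
    simp [← Set.inter_indicator_mul]
  have h := fkg (μ := fun G : SimpleGraph V ↦ G(V, p).real {G})
    (f := 𝓔.indicator fun _ ↦ (1 : ℝ)) (g := 𝓕.indicator fun _ ↦ 1) (fun _ ↦ measureReal_nonneg)
    (fun _ ↦ Set.indicator_nonneg (fun _ _ ↦ zero_le_one) _)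
    (fun _ ↦ Set.indicator_nonneg (fun _ _ ↦ zero_le_one) _) (hmono h𝓔) (hmono h𝓕)
    measureReal_singleton_mul_le
  have htotal : ∑ G, G(V, p).real {G} = 1 := by simp [sum_measureReal_singleton]
  simpa only [hinter, hreal, htotal, one_mul] using h

theorem measureReal_mul_le_of_isLowerSet {𝓔 𝓕 : Set (SimpleGraph V)} (h𝓔 : IsLowerSet 𝓔)
    (h𝓕 : IsLowerSet 𝓕) :
    G(V, p).real 𝓔 * G(V, p).real 𝓕 ≤ G(V, p).real (𝓔 ∩ 𝓕) := by
  have h := measureReal_mul_le_of_isUpperSet (p := p) h𝓔.compl h𝓕.compl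
  have hincl := measureReal_union_add_inter (μ := G(V, p)) (s := 𝓔) (t := 𝓕) .of_discrete
  rw [← Set.compl_union, probReal_compl_eq_one_sub .of_discrete,
    probReal_compl_eq_one_sub .of_discrete, probReal_compl_eq_one_sub .of_discrete] at h
  linarith

theorem prod_measureReal_le_of_isLowerSet {ι : Type*} (s : Finset ι)
    {𝓔 : ι → Set (SimpleGraph V)} (h : ∀ i, IsLowerSet (𝓔 i)) :
    ∏ i ∈ s, G(V, p).real (𝓔 i) ≤ G(V, p).real (⋂ i ∈ s, 𝓔 i) := by
  classical
  induction s using Finset.induction_on with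
  | empty => simp
  | insert i s hi ih =>
    rw [Finset.prod_insert hi, Finset.set_biInter_insert]
    exact (mul_le_mul_of_nonneg_left ih measureReal_nonneg).trans <|
      measureReal_mul_le_of_isLowerSet (h i) (isLowerSet_iInter₂ fun j _ ↦ h j)

end Harris

section Copies

variable {V W : Type*} {p : unitInterval} {H : SimpleGraph W}

theorem isContained_iff_exists_map_le {G : SimpleGraph V} : H ⊑ G ↔ ∃ g : W ↪ V, H.map g ≤ G :=
  ⟨fun ⟨f⟩ ↦ ⟨f.toEmbedding, (map_le_iff_le_comap _ _ _).2 fun _ _ h ↦ f.toHom.map_adj h⟩,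
    fun ⟨g, hg⟩ ↦ ⟨⟨g, fun h ↦ (map_le_iff_le_comap _ _ _).1 hg h⟩, g.injective⟩⟩

theorem ncard_edgeSet_map (g : W ↪ V) : (H.map g).edgeSet.ncard = H.edgeSet.ncard := by
  rw [edgeSet_map, Set.ncard_image_of_injective _ g.sym2Map.injective]

theorem ncard_edgeSet_map_inter_le [Finite W] (g h : W ↪ V) {S : Finset W}
    (hS : ∀ w, w ∈ S ↔ h w ∈ Set.range g) :
    ((H.map h).edgeSet ∩ (H.map g).edgeSet).ncard ≤ (H.edgeSet ∩ S.sym2).ncard := by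
  have hsub : (H.map h).edgeSet ∩ (H.map g).edgeSet ⊆ Sym2.map h '' (H.edgeSet ∩ S.sym2) := by
    rintro e ⟨heh, heg⟩
    induction e with | h a b
    obtain ⟨u, v, huv, rfl, rfl⟩ := (map_adj h H a b).1 heh
    obtain ⟨u', v', -, hu, hv⟩ := (map_adj g H _ _).1 heg
    exact ⟨s(u, v), ⟨huv, Finset.mk_mem_sym2_iff.2 ⟨(hS u).2 ⟨u', hu⟩, (hS v).2 ⟨v', hv⟩⟩⟩, rfl⟩
  exact (Set.ncard_le_ncard hsub).trans (Set.ncard_image_le (Set.toFinite _))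

theorem measureReal_map_le [Finite V] (g : W ↪ V) :
    G(V, p).real {G | H.map g ≤ G} = (p : ℝ) ^ H.edgeSet.ncard := by
  rw [measureReal_ge, ncard_edgeSet_map]

theorem measureReal_map_le_inter_le [Finite V] [Finite W] (g h : W ↪ V) {S : Finset W}
    (hS : ∀ w, w ∈ S ↔ h w ∈ Set.range g) :
    G(V, p).real ({G | H.map g ≤ G} ∩ {G | H.map h ≤ G}) ≤ (p : ℝ) ^ H.edgeSet.ncard *
      (p : ℝ) ^ (H.edgeSet.ncard - (H.edgeSet ∩ S.sym2).ncard) := by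
  have hinter : {G | H.map g ≤ G} ∩ {G | H.map h ≤ G} = {G | H.map h ⊔ H.map g ≤ G} := by
    ext G
    exact and_comm.trans (sup_le_iff (α := SimpleGraph V)).symm
  have hunion := Set.ncard_union_add_ncard_inter (H.map h).edgeSet (H.map g).edgeSet
  have hshared := ncard_edgeSet_map_inter_le (H := H) g h hS
  have hle := Set.ncard_inter_le_ncard_left (H.map h).edgeSet (H.map g).edgeSet
  rw [ncard_edgeSet_map] at hunion hle
  rw [ncard_edgeSet_map] at hunion
  rw [hinter, measureReal_ge, edgeSet_sup, ← pow_add]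
  exact pow_le_pow_of_le_one p.2.1 p.2.2 (by omega)

variable [Fintype V] [Fintype W]

theorem card_filter_preimage_range_le [DecidableEq W] (g : W ↪ V) (T : (W ↪ V) → Finset W)
    (hT : ∀ h w, w ∈ T h ↔ h w ∈ Set.range g) (S : Finset W) :
    (Finset.univ.filter (T · = S)).card ≤
      Fintype.card W ^ S.card * Fintype.card V ^ (Fintype.card W - S.card) := by
  classical
  have hmaps : (Finset.univ.filter (T · = S)).card ≤
      (Fintype.piFinset fun w ↦ if w ∈ S then Finset.univ.map g else Finset.univ).card := by
    refine Finset.card_le_card_of_injOn (fun h ↦ ⇑h) (fun h hh ↦ ?_)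
      DFunLike.coe_injective.injOn
    obtain rfl : T h = S := by simpa using hh
    refine Finset.mem_coe.2 (Fintype.mem_piFinset.2 fun w ↦ ?_)
    split_ifs with hw
    · simpa using (hT h w).1 hw
    · simp
  refine hmaps.trans_eq ?_
  simp [Fintype.card_piFinset, apply_ite Finset.card, Finset.prod_ite, Finset.filter_not,
    ← Finset.compl_eq_univ_sdiff, Finset.card_compl]

theorem sum_measureReal_map_le_inter_le
    (hH : ∀ S : Finset W, (Fintype.card V : ℝ) ^ (Fintype.card W - S.card) *
      (p : ℝ) ^ (H.edgeSet.ncard - (H.edgeSet ∩ S.sym2).ncard) ≤ 1) (g : W ↪ V) :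
    ∑ h : W ↪ V, G(V, p).real ({G | H.map g ≤ G} ∩ {G | H.map h ≤ G}) ≤
      (p : ℝ) ^ H.edgeSet.ncard * (2 * Fintype.card W) ^ Fintype.card W := by
  classical
  let T (h : W ↪ V) : Finset W := {w | h w ∈ Set.range g}
  have hT : ∀ h w, w ∈ T h ↔ h w ∈ Set.range g := fun h w ↦ by simp [T]
  have hfiber : ∀ S : Finset W, ∑ h with T h = S,
      (p : ℝ) ^ (H.edgeSet.ncard - (H.edgeSet ∩ (T h).sym2).ncard) ≤
        (Fintype.card W : ℝ) ^ Fintype.card W := fun S ↦ by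
    have hp := p.2.1
    have hcard := S.card_le_univ
    calc ∑ h with T h = S, (p : ℝ) ^ (H.edgeSet.ncard - (H.edgeSet ∩ (T h).sym2).ncard)
        = (Finset.univ.filter (T · = S)).card *
            (p : ℝ) ^ (H.edgeSet.ncard - (H.edgeSet ∩ S.sym2).ncard) := by
          rw [← nsmul_eq_mul]
          exact Finset.sum_eq_card_nsmul fun h hh ↦ by rw [(Finset.mem_filter.1 hh).2]
      _ ≤ ((Fintype.card W : ℝ) ^ S.card * Fintype.card V ^ (Fintype.card W - S.card)) *
            (p : ℝ) ^ (H.edgeSet.ncard - (H.edgeSet ∩ S.sym2).ncard) := by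
          gcongr
          exact_mod_cast card_filter_preimage_range_le g T hT S
      _ ≤ (Fintype.card W : ℝ) ^ S.card := by
          rw [mul_assoc]
          exact mul_le_of_le_one_right (by positivity) (hH S)
      _ ≤ (Fintype.card W : ℝ) ^ Fintype.card W := by
          rcases S.eq_empty_or_nonempty with rfl | ⟨w, -⟩
          · rcases Nat.eq_zero_or_pos (Fintype.card W) with h0 | h0
            · simp [h0]
            · exact one_le_pow₀ (by exact_mod_cast h0)
          · exact pow_le_pow_right₀ (by exact_mod_cast Fintype.card_pos_iff.2 ⟨w⟩) hcard
  refine (Finset.sum_le_sum fun h _ ↦ measureReal_map_le_inter_le g h (hT h)).trans ?_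
  rw [← Finset.mul_sum, ← Finset.sum_fiberwise Finset.univ T]
  refine mul_le_mul_of_nonneg_left ?_ (pow_nonneg p.2.1 _)
  refine (Finset.sum_le_sum fun S _ ↦ hfiber S).trans_eq ?_
  simp [mul_pow]

theorem card_embedding_le : Fintype.card (W ↪ V) ≤ Fintype.card V ^ Fintype.card W := by
  rw [Fintype.card_embedding_eq]
  exact Nat.descFactorial_le_pow _ _

theorem half_pow_le_card_embedding
    (h : 2 * Fintype.card W ^ 2 ≤ Fintype.card V) :
    (Fintype.card V : ℝ) ^ Fintype.card W / 2 ≤ Fintype.card (W ↪ V) := by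
  set n := Fintype.card V
  set v := Fintype.card W
  rcases Nat.eq_zero_or_pos n with hn | hn
  · have hv : v = 0 := by nlinarith
    simp [Fintype.card_embedding_eq, n, v, hv]
    norm_num
  have hvn : v ≤ n := by nlinarith
  have hn0 : (0 : ℝ) < n := by exact_mod_cast hn
  have hbern := one_add_mul_le_pow (a := -((v : ℝ) / n))
    (by linarith [(div_le_one hn0).2 (Nat.cast_le.2 hvn : (v : ℝ) ≤ n)]) v
  have hsmall : (v : ℝ) * (v / n) ≤ 1 / 2 := by
    rw [← mul_div_assoc, div_le_iff₀ hn0]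
    have : (2 * v ^ 2 : ℝ) ≤ n := by exact_mod_cast h
    linarith
  calc (n : ℝ) ^ v / 2 = (n : ℝ) ^ v * (1 / 2) := by ring
    _ ≤ (n : ℝ) ^ v * (1 + -((v : ℝ) / n)) ^ v := by gcongr; linarith
    _ = ((n - v : ℕ) : ℝ) ^ v := by
        rw [← mul_pow, Nat.cast_sub hvn]
        congr 1
        field_simp
        ring
    _ ≤ Fintype.card (W ↪ V) := by
        rw [Fintype.card_embedding_eq]
        exact_mod_cast (Nat.pow_le_pow_left (by omega) _).trans (Nat.pow_sub_le_descFactorial n v)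

theorem sum_sum_measureReal_map_le_inter_le
    (hH : ∀ S : Finset W, (Fintype.card V : ℝ) ^ (Fintype.card W - S.card) *
      (p : ℝ) ^ (H.edgeSet.ncard - (H.edgeSet ∩ S.sym2).ncard) ≤ 1) :
    ∑ g : W ↪ V, ∑ h : W ↪ V, G(V, p).real ({G | H.map g ≤ G} ∩ {G | H.map h ≤ G}) ≤
      (2 * Fintype.card W) ^ Fintype.card W := by
  refine (Finset.sum_le_sum fun g _ ↦ sum_measureReal_map_le_inter_le hH g).trans ?_
  have hp := p.2.1
  have hempty : (Fintype.card V : ℝ) ^ Fintype.card W * (p : ℝ) ^ H.edgeSet.ncard ≤ 1 := by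
    simpa using hH ∅
  rw [Finset.sum_const, nsmul_eq_mul, Finset.card_univ, ← mul_assoc]
  refine mul_le_of_le_one_left (by positivity) (le_trans ?_ hempty)
  gcongr
  exact_mod_cast card_embedding_le

theorem measureReal_isContained_le (θ : H ≃g H) (hθ : ∃ w, θ w ≠ w) :
    G(V, p).real {G | H ⊑ G} ≤
      (Fintype.card V : ℝ) ^ Fintype.card W * (p : ℝ) ^ H.edgeSet.ncard / 2 := by
  classical
  obtain ⟨w, hw⟩ := hθ
  have hp := p.2.1
  have htwo := two_mul_measureReal_iUnion_le (μ := G(V, p))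
    (S := fun g : W ↪ V ↦ {G | H.map g ≤ G}) (τ := fun g ↦ θ.toEquiv.toEmbedding.trans g)
    (fun _ ↦ .of_discrete) (fun g h ↦ hw (g.injective (DFunLike.congr_fun h w)))
    (fun g G hG ↦ (map_le_iff_le_comap _ _ _).2 fun a b hab ↦
      (map_le_iff_le_comap _ _ _).1 hG (θ.map_adj_iff.2 hab))
  simp only [measureReal_map_le, Finset.sum_const, Finset.card_univ, nsmul_eq_mul] at htwo
  have hcard : (Fintype.card (W ↪ V) : ℝ) ≤ (Fintype.card V : ℝ) ^ Fintype.card W := by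
    exact_mod_cast card_embedding_le
  have hsum := mul_le_mul_of_nonneg_right hcard (pow_nonneg hp H.edgeSet.ncard)
  have hunion : {G : SimpleGraph V | H ⊑ G} = ⋃ g : W ↪ V, {G | H.map g ≤ G} := by
    ext G
    simpa using isContained_iff_exists_map_le
  rw [hunion]
  linarith

end Copies

section Fan

variable {V : Type*} {k : ℕ}

/-- A complete graph on `Fin 4` and `k` further vertices, adjacent to the first two vertices of
`Fin 4` (the hubs) only. -/
def fan (k : ℕ) : SimpleGraph (Fin 4 ⊕ Fin k) where
  Adj
    | .inl i, .inl j => i ≠ j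
    | .inl i, .inr _ => i < 2
    | .inr _, .inl j => j < 2
    | .inr _, .inr _ => False
  symm.symm := by rintro (i | i) (j | j) h <;> first | exact h.symm | exact h
  loopless.irrefl := by rintro (i | i) h <;> first | exact h rfl | exact h

@[simp] theorem fan_adj_inl_inl {i j : Fin 4} : (fan k).Adj (.inl i) (.inl j) ↔ i ≠ j := Iff.rfl

@[simp] theorem fan_adj_inl_inr {i : Fin 4} {j : Fin k} :
    (fan k).Adj (.inl i) (.inr j) ↔ i < 2 := Iff.rfl

@[simp] theorem fan_adj_inr_inl {i : Fin k} {j : Fin 4} :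
    (fan k).Adj (.inr i) (.inl j) ↔ j < 2 := Iff.rfl

@[simp] theorem not_fan_adj_inr_inr {i j : Fin k} : ¬ (fan k).Adj (.inr i) (.inr j) := id

theorem ncard_edgeSet_fan_inter_sym2 (S : Finset (Fin 4 ⊕ Fin k)) :
    ((fan k).edgeSet ∩ S.sym2).ncard =
      S.toLeft.card.choose 2 + (S.toLeft.filter (· < 2)).card * S.toRight.card := by
  have hinl : Function.Injective (Sym2.map (Sum.inl : Fin 4 → Fin 4 ⊕ Fin k)) :=
    Sym2.map.injective Sum.inl_injective
  have hmix : Function.Injective fun x : Fin 4 × Fin k ↦ s(Sum.inl x.1, Sum.inr x.2) := by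
    rintro ⟨a, b⟩ ⟨c, d⟩ h
    simpa using h
  have hunion : (fan k).edgeSet ∩ S.sym2 =
      ↑((S.toLeft.offDiag.image Sym2.mk.uncurry).map ⟨_, hinl⟩ ∪
        ((S.toLeft.filter (· < 2)) ×ˢ S.toRight).map ⟨_, hmix⟩) := by
    ext e
    induction e with | h a b
    rcases a with a | a <;> rcases b with b | b <;> aesop
  have hdisj : Disjoint ((S.toLeft.offDiag.image Sym2.mk.uncurry).map ⟨_, hinl⟩)
      (((S.toLeft.filter (· < 2)) ×ˢ S.toRight).map ⟨_, hmix⟩) := by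
    simp only [Finset.disjoint_left, Finset.mem_map, Finset.mem_image, Finset.mem_product]
    aesop
  rw [hunion, Set.ncard_coe_finset, Finset.card_union_of_disjoint hdisj, Finset.card_map,
    Finset.card_map, Sym2.card_image_offDiag, Finset.card_product]

theorem ncard_edgeSet_fan : (fan k).edgeSet.ncard = 2 * (k + 3) := by
  have h := ncard_edgeSet_fan_inter_sym2 (k := k) Finset.univ
  have hhub : (Finset.univ.filter fun i : Fin 4 ↦ i < 2).card = 2 := by decide
  have hchoose : Nat.choose 4 2 = 6 := by decide
  simp only [Finset.sym2_univ, Finset.coe_univ, Set.inter_univ, Finset.toLeft_univ,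
    Finset.toRight_univ, hhub, Finset.card_univ, Fintype.card_fin, hchoose] at h
  omega

theorem ncard_edgeSet_fan_inter_sym2_add_two_le {S : Finset (Fin 4 ⊕ Fin k)} (hS : S.Nonempty) :
    ((fan k).edgeSet ∩ S.sym2).ncard + 2 ≤ 2 * S.card := by
  have hK : ∀ T : Finset (Fin 4), T.Nonempty → T.card.choose 2 + 2 ≤ 2 * T.card := by decide
  have hhub : ∀ T : Finset (Fin 4), (T.filter (· < 2)).card ≤ 2 := by decide
  have hcard := S.card_toLeft_add_card_toRight
  have hpos := hS.card_pos
  rw [ncard_edgeSet_fan_inter_sym2]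
  rcases S.toLeft.eq_empty_or_nonempty with h | h
  · simp only [h, Finset.card_empty, Nat.choose_zero_succ, Finset.filter_empty] at hcard ⊢
    omega
  · have := Nat.mul_le_mul_right S.toRight.card (hhub S.toLeft)
    have := hK _ h
    omega

/-- The automorphism of the fan graph exchanging the two hubs. -/
def fanSwapHubs (k : ℕ) : fan k ≃g fan k where
  toEquiv := (Equiv.swap 0 1).sumCongr (Equiv.refl _)
  map_rel_iff' := by
    have hlt : ∀ i : Fin 4, Equiv.swap 0 1 i < 2 ↔ i < 2 := by decide
    rintro (i | i) (j | j)
    exacts [(Equiv.swap 0 1).injective.ne_iff, hlt i, hlt j, Iff.rfl]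

theorem exists_adj_ne_of_triangle {G : SimpleGraph V} {X : Set V} {a b c : V} (ha : a ∈ X)
    (hb : b ∈ X) (hc : c ∈ X) (hab : G.Adj a b) (hac : G.Adj a c) (hbc : G.Adj b c) (x : V) :
    ∃ a ∈ X, ∃ b ∈ X, a ≠ x ∧ b ≠ x ∧ G.Adj a b := by
  by_cases hax : a = x
  · exact ⟨b, hb, c, hc, hax ▸ hab.ne', hax ▸ hac.ne', hbc⟩
  by_cases hbx : b = x
  · exact ⟨a, ha, c, hc, hax, hbx ▸ hbc.ne', hac⟩
  · exact ⟨a, ha, b, hb, hax, hbx, hab⟩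

theorem fan_isContained_of_adj {G : SimpleGraph V} {y x a b : V} (c : Fin k ↪ V)
    (hyx : G.Adj y x) (hya : G.Adj y a) (hyb : G.Adj y b) (hyc : ∀ i, G.Adj y (c i))
    (hxa : G.Adj x a) (hxb : G.Adj x b) (hxc : ∀ i, G.Adj x (c i)) (hab : G.Adj a b)
    (hac : ∀ i, c i ≠ a) (hbc : ∀ i, c i ≠ b) : fan k ⊑ G := by
  refine ⟨⟨⟨Sum.elim ![y, x, a, b] c, ?_⟩, ?_⟩⟩
  · have hhub : ∀ i : Fin 4, i < 2 → i = 0 ∨ i = 1 := by decide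
    rintro (i | i) (j | j) hij
    · fin_cases i <;> fin_cases j <;>
        simp_all [adj_comm]
    · rcases hhub i hij with rfl | rfl <;> simp [hyc, hxc]
    · rcases hhub j hij with rfl | rfl <;> simp [(hyc _).symm, (hxc _).symm]
    · exact hij.elim
  · refine Function.Injective.sumElim ?_ c.injective fun i j ↦ ?_
    · intro i j
      fin_cases i <;> fin_cases j <;> simp [hyx.ne, hya.ne, hyb.ne, hxa.ne, hxb.ne, hab.ne,
        hyx.ne', hya.ne', hyb.ne', hxa.ne', hxb.ne', hab.ne']
    · fin_cases i <;> simp [(hyc j).ne, (hxc j).ne, (hac j).symm, (hbc j).symm]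

theorem IsFanSet.one_lt_ncard [Finite V] {G : SimpleGraph V} {X : Set V} (h : IsFanSet G X) :
    1 < X.ncard := by
  obtain ⟨-, -, a, b, -, ha, hb, -, hab, -⟩ := h
  exact (Set.one_lt_ncard X.toFinite).2 ⟨a, ha, b, hb, hab.ne⟩

theorem IsFanSet.fan_isContained {G : SimpleGraph V} {X : Set V} (h : IsFanSet G X)
    (hX : k + 3 ≤ X.ncard) : fan k ⊑ G := by
  classical
  obtain ⟨⟨y, hy⟩, ⟨x, hx, hxX⟩, a, b, c, ha, hb, hc, hab, hac, hbc⟩ := h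
  obtain ⟨a, ha, b, hb, hax, hbx, hab⟩ :=
    exists_adj_ne_of_triangle ha hb hc hab hac hbc x
  have hxu : ∀ u ∈ X, u ≠ x → G.Adj x u := fun u hu hux ↦ (hxX u hu).resolve_left hux
  have hX' : X.Finite := Set.finite_of_ncard_pos (by omega)
  have hcard : k ≤ (X \ ({x, a, b} : Finset V)).ncard := by
    have h1 := Set.le_ncard_sdiff (↑({x, a, b} : Finset V)) X
    have h2 := Finset.card_le_three (a := x) (b := a) (c := b)
    rw [Set.ncard_coe_finset] at h1
    omega
  obtain ⟨l⟩ : Nonempty (Fin k ↪ (X \ ({x, a, b} : Finset V) : Set V)) := by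
    have := hX'.sdiff (t := ({x, a, b} : Finset V)) |>.fintype
    exact Function.Embedding.nonempty_of_card_le
      (by rwa [Fintype.card_fin, ← Nat.card_eq_fintype_card])
  have hl : ∀ i, (l i : V) ∈ X ∧ (l i : V) ≠ x ∧ (l i : V) ≠ a ∧ (l i : V) ≠ b := fun i ↦ by
    simpa using (l i).2
  exact fan_isContained_of_adj (l.trans (.subtype _)) (hy x hx) (hy a ha) (hy b hb)
    (fun i ↦ hy _ (hl i).1) (hxu a ha hax) (hxu b hb hbx) (fun i ↦ hxu _ (hl i).1 (hl i).2.1) hab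
    (fun i ↦ (hl i).2.2.1) fun i ↦ (hl i).2.2.2

/-- Some vertex outside `X` is joined to every element of `X` by a path of length two whose middle
vertex avoids `Y`. -/
def HasDetour (G : SimpleGraph V) (X Y : Set V) : Prop :=
  ∃ v ∉ X, ∀ u ∈ X, ∃ w ∉ Y, G.Adj w u ∧ G.Adj w v

theorem not_isCentered_of_not_hasDetour {G : SimpleGraph V} {X : Set V} {y : V}
    (hy : ∀ u ∈ X, G.Adj y u) (h : ¬ HasDetour G X (insert y X)) : ¬ IsCentered G X := by
  rintro ⟨v, hv, hdom⟩
  have hyv : ¬ G.Adj y v := fun hyv ↦ hdom ⟨y, hyv, hy⟩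
  refine h ⟨v, fun hvX ↦ hyv (hy v hvX), fun u hu ↦ ?_⟩
  obtain ⟨w, hwX, hwu, hwv⟩ := hv u hu
  refine ⟨w, ?_, hwu, hwv⟩
  rintro (rfl | hw)
  exacts [hyv hwv, hwX hw]

theorem isFanSet_image_compl_of_fan_map_le {G : SimpleGraph V} {g : Fin 4 ⊕ Fin k ↪ V}
    (hg : (fan k).map g ≤ G) : IsFanSet G (g '' {.inl 0}ᶜ) := by
  have hadj : ∀ a b, (fan k).Adj a b → G.Adj (g a) (g b) := fun _ _ h ↦
    (map_le_iff_le_comap _ _ _).1 hg h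
  have hmem : ∀ i : Fin 4, i ≠ 0 → g (.inl i) ∈ g '' {.inl 0}ᶜ := fun i hi ↦ ⟨_, by simpa, rfl⟩
  refine ⟨⟨g (.inl 0), ?_⟩, ⟨g (.inl 1), hmem 1 (by decide), ?_⟩,
    g (.inl 1), g (.inl 2), g (.inl 3), hmem 1 (by decide), hmem 2 (by decide),
    hmem 3 (by decide), hadj _ _ (by simp), hadj _ _ (by simp), hadj _ _ (by simp)⟩
  · rintro _ ⟨a | a, ha, rfl⟩
    · exact hadj _ _ (by simpa [eq_comm] using ha)
    · exact hadj _ _ (by simp)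
  · rintro _ ⟨a | a, ha, rfl⟩
    · rcases eq_or_ne a 1 with rfl | h
      · exact Or.inl rfl
      · exact Or.inr (hadj _ _ (by simpa [eq_comm] using h))
    · exact Or.inr (hadj _ _ (by simp))

theorem exists_isFanSet_not_isCentered_of_fan_map_le {G : SimpleGraph V} {g : Fin 4 ⊕ Fin k ↪ V}
    (hg : (fan k).map g ≤ G) (h : ¬ HasDetour G (g '' {.inl 0}ᶜ) (Set.range g)) :
    ∃ X, IsFanSet G X ∧ ¬ IsCentered G X := by
  have hrange : Set.range g = insert (g (.inl 0)) (g '' {.inl 0}ᶜ) := by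
    rw [← Set.image_insert_eq, Set.insert_eq, Set.union_compl_self, Set.image_univ]
  refine ⟨_, isFanSet_image_compl_of_fan_map_le hg,
    not_isCentered_of_not_hasDetour (y := g (.inl 0)) ?_ (hrange ▸ h)⟩
  rintro _ ⟨a, ha, rfl⟩
  refine (map_le_iff_le_comap _ _ _).1 hg ?_
  rcases a with a | a
  · simpa [eq_comm] using ha
  · simp

end Fan

section Detour

variable {V : Type*} {p : unitInterval} {X : Finset V} {Y : Set V}

theorem not_hasDetour_iff {G : SimpleGraph V} :
    ¬ HasDetour G X Y ↔ ∀ v ∉ X, ∀ f : X → V, (∀ u, f u ∉ Y) →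
      ¬ ∀ u, G.Adj (f u) u ∧ G.Adj (f u) v := by
  simp only [HasDetour, not_exists, not_and, Finset.mem_coe]
  refine forall₂_congr fun v _ ↦ ⟨fun h f hf hadj ↦ h fun u hu ↦ ⟨f ⟨u, hu⟩, hf _, hadj ⟨u, hu⟩⟩,
    fun h hadj ↦ ?_⟩
  choose f hf hfadj using hadj
  exact h (fun u ↦ f u u.2) (fun u ↦ hf u u.2) fun u ↦ hfadj u u.2

theorem measureReal_forall_adj_and_adj_le [Finite V] [DecidableEq V] {v : V} (hv : v ∉ X)
    {f : X → V} (hf : ∀ u, f u ∉ X) :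
    G(V, p).real {G | ∀ u, G.Adj (f u) u ∧ G.Adj (f u) v} ≤
      (p : ℝ) ^ (X.card + (Finset.univ.image f).card) := by
  by_cases hfv : ∃ u, f u = v
  · obtain ⟨u, hu⟩ := hfv
    have : {G : SimpleGraph V | ∀ u, G.Adj (f u) u ∧ G.Adj (f u) v} = ∅ :=
      Set.eq_empty_of_forall_notMem fun G hG ↦ (hG u).2.ne hu
    rw [this, measureReal_empty]
    have := p.2.1
    positivity
  push Not at hfv
  have hfX : ∀ u u' : X, f u ≠ u' := fun u u' h ↦ hf u (h ▸ u'.2)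
  have : ∀ u : X, v ≠ u := fun u h ↦ hv (h ▸ u.2)
  let E : Finset (Sym2 V) := Finset.univ.image (fun u ↦ s(f u, u.1)) ∪
    (Finset.univ.image f).image fun w ↦ s(w, v)
  have hcard : E.card = X.card + (Finset.univ.image f).card := by
    rw [Finset.card_union_of_disjoint, Finset.card_image_of_injective, Finset.card_univ,
      Fintype.card_coe, Finset.card_image_of_injective _ fun _ _ ↦ Sym2.congr_left.1]
    · intro u u' huu'
      have := Sym2.eq_iff.1 huu'
      grind
    · simp only [Finset.disjoint_left, Finset.mem_image, forall_exists_index, and_imp]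
      rintro _ u - rfl ⟨_, ⟨u', -, rfl⟩, hw⟩
      have := Sym2.eq_iff.1 hw
      grind
  have hE : (fromEdgeSet (E : Set (Sym2 V))).edgeSet = E := by
    rw [edgeSet_fromEdgeSet, sdiff_eq_left, Set.disjoint_left]
    simp only [E, Finset.coe_union, Finset.coe_image, Finset.coe_univ]
    rintro _ (⟨u, -, rfl⟩ | ⟨_, ⟨u, -, rfl⟩, rfl⟩)
    exacts [hfX u u, hfv u]
  rw [← hcard, ← Set.ncard_coe_finset, ← hE, ← measureReal_ge]
  refine measureReal_mono fun G hG ↦ ?_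
  rw [Set.mem_ofPred_eq, ← edgeSet_subset_edgeSet, hE]
  simp only [E, Finset.coe_union, Finset.coe_image, Finset.coe_univ]
  rintro _ (⟨u, -, rfl⟩ | ⟨_, ⟨u, -, rfl⟩, rfl⟩)
  exacts [(hG u).1, (hG u).2]

variable [Fintype V]

/-- A function is encoded by choosing one index in each fibre, recording the value there and the
chosen index elsewhere; the encodings are counted by expanding the power. -/
theorem sum_pow_card_image_le [DecidableEq V] {ι : Type*} [Fintype ι] [DecidableEq ι] {q : ℝ}
    (hq : 0 ≤ q) :
    ∑ f : ι → V, q ^ (Finset.univ.image f).card ≤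
      (Fintype.card V * q + Fintype.card ι) ^ Fintype.card ι := by
  let rep (f : ι → V) (i : ι) : ι := Set.rangeSplitting f (Set.rangeFactorization f i)
  have hrep : ∀ (f : ι → V) i, f (rep f i) = f i := fun f i ↦ Set.apply_rangeSplitting f _
  have hrep_eq : ∀ (f : ι → V) i j, f i = f j → rep f i = rep f j := fun f i j h ↦
    congrArg (Set.rangeSplitting f) (Subtype.ext h)
  let code (f : ι → V) (i : ι) : V ⊕ ι := if rep f i = i then .inl (f i) else .inr (rep f i)
  have hcode : Function.Injective code := fun f g hfg ↦ by
    have hfix : ∀ i, rep f i = i → f i = g i := fun i hi ↦ by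
      have := congrFun hfg i
      grind
    funext i
    have := congrFun hfg i
    grind
  let weight : V ⊕ ι → ℝ := Sum.elim (fun _ ↦ q) fun _ ↦ 1
  have hweight : ∀ f, q ^ (Finset.univ.image f).card = ∏ i, weight (code f i) := fun f ↦ by
    have hcard : (Finset.univ.filter fun i ↦ rep f i = i).card = (Finset.univ.image f).card := by
      refine Finset.card_bij (fun i _ ↦ f i) (by simp) ?_ ?_ <;> grind
    rw [← hcard, ← Finset.prod_const, Finset.prod_filter]
    refine Finset.prod_congr rfl fun i _ ↦ ?_
    simp only [code]
    split_ifs <;> rfl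
  calc ∑ f : ι → V, q ^ (Finset.univ.image f).card
      = ∑ f, ∏ i, weight (code f i) := Finset.sum_congr rfl fun f _ ↦ hweight f
    _ ≤ ∑ c : ι → V ⊕ ι, ∏ i, weight (c i) := by
        rw [← Finset.sum_image (f := fun c ↦ ∏ i, weight (c i)) hcode.injOn]
        refine Finset.sum_le_sum_of_subset_of_nonneg (Finset.subset_univ _) fun c _ _ ↦
          Finset.prod_nonneg fun i _ ↦ ?_
        exact Sum.rec (fun _ ↦ hq) (fun _ ↦ zero_le_one) (c i)
    _ = (∑ x, weight x) ^ Fintype.card ι := by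
        rw [← Finset.card_univ, ← Finset.prod_const, Finset.prod_univ_sum, Fintype.piFinset_univ]
    _ = (Fintype.card V * q + Fintype.card ι) ^ Fintype.card ι := by
        simp [weight]

theorem exp_neg_two_mul_le_one_sub {x : ℝ} (h0 : 0 ≤ x) (h1 : x ≤ 1 / 2) :
    Real.exp (-(2 * x)) ≤ 1 - x := by
  rw [Real.exp_neg]
  have h2 := Real.add_one_le_exp (2 * x)
  rw [inv_le_comm₀ (Real.exp_pos _) (by linarith), inv_le_iff_one_le_mul₀ (by linarith)]
  nlinarith

theorem sum_sum_pow_card_image_le [DecidableEq V] (hnp : 1 ≤ (Fintype.card V : ℝ) * p)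
    (h : (Fintype.card V : ℝ) ^ (X.card + 1) * (p : ℝ) ^ (2 * X.card) ≤ 1) :
    ∑ _v : V, ∑ f : X → V, (p : ℝ) ^ (X.card + (Finset.univ.image f).card) ≤
      (X.card + 1 : ℝ) ^ X.card := by
  have hp := p.2.1
  set n : ℝ := (Fintype.card V : ℝ) with hn
  simp only [pow_add (p : ℝ) X.card, ← Finset.mul_sum, Finset.sum_const, Finset.card_univ,
    nsmul_eq_mul, ← hn, mul_left_comm _ n]
  calc n * ((p : ℝ) ^ X.card * ∑ f : X → V, (p : ℝ) ^ (Finset.univ.image f).card)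
      ≤ n * ((p : ℝ) ^ X.card * (n * p + X.card) ^ X.card) := by
        gcongr
        simpa using sum_pow_card_image_le (V := V) (ι := X) hp
    _ ≤ n * ((p : ℝ) ^ X.card * (n * p * (X.card + 1)) ^ X.card) := by
        gcongr
        nlinarith [(Nat.cast_nonneg X.card : (0 : ℝ) ≤ X.card)]
    _ = n ^ (X.card + 1) * (p : ℝ) ^ (2 * X.card) * (X.card + 1) ^ X.card := by
        rw [mul_pow, mul_pow]
        ring
    _ ≤ (X.card + 1 : ℝ) ^ X.card := mul_le_of_le_one_left (by positivity) h

theorem exp_neg_le_measureReal_not_hasDetour (hX : X.Nonempty) (hXY : (X : Set V) ⊆ Y)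
    (hp : (p : ℝ) ≤ 1 / 2) (hnp : 1 ≤ (Fintype.card V : ℝ) * p)
    (h : (Fintype.card V : ℝ) ^ (X.card + 1) * (p : ℝ) ^ (2 * X.card) ≤ 1) :
    Real.exp (-(2 * (X.card + 1) ^ X.card)) ≤ G(V, p).real {G | ¬ HasDetour G X Y} := by
  classical
  let I : Finset (V × (X → V)) := Finset.univ.filter fun x ↦ x.1 ∉ X ∧ ∀ u, x.2 u ∉ Y
  let 𝓓 (x : V × (X → V)) : Set (SimpleGraph V) := {G | ∀ u, G.Adj (x.2 u) u ∧ G.Adj (x.2 u) x.1}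
  let N (x : V × (X → V)) : ℕ := X.card + (Finset.univ.image x.2).card
  have h𝓓 : ∀ x ∈ I, G(V, p).real (𝓓 x) ≤ (p : ℝ) ^ N x := fun x hx ↦ by
    obtain ⟨hv, hf⟩ := (Finset.mem_filter.1 hx).2
    exact measureReal_forall_adj_and_adj_le hv fun u hu ↦ hf u (hXY hu)
  have hsum : ∑ x ∈ I, (p : ℝ) ^ N x ≤ (X.card + 1) ^ X.card := by
    refine le_trans ?_ (sum_sum_pow_card_image_le hnp h)
    rw [← Fintype.sum_prod_type']
    exact Finset.sum_le_sum_of_subset_of_nonneg (Finset.subset_univ _)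
      fun x _ _ ↦ pow_nonneg p.2.1 _
  have hN : ∀ x, (p : ℝ) ^ N x ≤ 1 / 2 := fun x ↦
    (pow_le_of_le_one p.2.1 p.2.2 (by simp [N, hX.ne_empty])).trans hp
  calc Real.exp (-(2 * (X.card + 1) ^ X.card))
      ≤ Real.exp (∑ x ∈ I, -(2 * (p : ℝ) ^ N x)) := by
        rw [Real.exp_le_exp, Finset.sum_neg_distrib, ← Finset.mul_sum]
        linarith
    _ = ∏ x ∈ I, Real.exp (-(2 * (p : ℝ) ^ N x)) := Real.exp_sum _ _
    _ ≤ ∏ x ∈ I, G(V, p).real (𝓓 x)ᶜ := by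
        refine Finset.prod_le_prod (fun x _ ↦ (Real.exp_pos _).le) fun x hx ↦ ?_
        rw [probReal_compl_eq_one_sub .of_discrete]
        exact (exp_neg_two_mul_le_one_sub (pow_nonneg p.2.1 _) (hN x)).trans
          (by linarith [h𝓓 x hx])
    _ ≤ G(V, p).real (⋂ x ∈ I, (𝓓 x)ᶜ) :=
        prod_measureReal_le_of_isLowerSet I fun x ↦ IsUpperSet.compl fun _ _ hGH hG u ↦
          ⟨hGH (hG u).1, hGH (hG u).2⟩
    _ = G(V, p).real {G | ¬ HasDetour G X Y} := by
        congr 1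
        ext G
        simp only [I, 𝓓, Set.mem_iInter, Finset.mem_filter_univ, Set.mem_compl_iff,
          Set.mem_ofPred_eq, not_hasDetour_iff]
        exact ⟨fun h v hv f hf ↦ h (v, f) ⟨hv, hf⟩, fun h x hx ↦ h x.1 hx.1 x.2 hx.2⟩

end Detour

section LowerBound

variable {V : Type*} {p : unitInterval} {k : ℕ}

theorem dependsOnPairs_not_hasDetour (X Y : Set V) :
    DependsOnPairs {G | ¬ HasDetour G X Y} {e | ∃ w ∈ e, w ∉ Y} := by
  rintro G H hGH hG ⟨v, hv, h⟩
  have hadj : ∀ {w u}, w ∉ Y → (H.Adj w u ↔ G.Adj w u) := fun {w u} hw ↦ by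
    simpa [hw] using (Set.ext_iff.1 hGH s(w, u)).symm
  refine hG ⟨v, hv, fun u hu ↦ ?_⟩
  obtain ⟨w, hw, hwu, hwv⟩ := h u hu
  exact ⟨w, hw, (hadj hw).1 hwu, (hadj hw).1 hwv⟩

theorem indepSet_map_le_not_hasDetour [Finite V] {W : Type*} (H : SimpleGraph W) (g : W ↪ V)
    (X : Set V) :
    IndepSet {G | H.map g ≤ G} {G | ¬ HasDetour G X (Set.range g)} G(V, p) := by
  refine (dependsOnPairs_ge _).indepSet (dependsOnPairs_not_hasDetour X _) ?_
  rw [Set.disjoint_left, edgeSet_map]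
  rintro _ ⟨e, -, rfl⟩ ⟨w, hw, hwg⟩
  obtain ⟨a, -, rfl⟩ := Sym2.mem_map.1 hw
  exact hwg ⟨a, rfl⟩

variable [Fintype V]

theorem card_pow_mul_pow_fan_le_one (h2 : (Fintype.card V : ℝ) * (p : ℝ) ^ 2 ≤ 1)
    (h : (Fintype.card V : ℝ) ^ (k + 4) * (p : ℝ) ^ (2 * (k + 3)) ≤ 1)
    (S : Finset (Fin 4 ⊕ Fin k)) :
    (Fintype.card V : ℝ) ^ (Fintype.card (Fin 4 ⊕ Fin k) - S.card) *
      (p : ℝ) ^ ((fan k).edgeSet.ncard - ((fan k).edgeSet ∩ S.sym2).ncard) ≤ 1 := by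
  have hp := p.2.1
  have hcard : Fintype.card (Fin 4 ⊕ Fin k) = k + 4 := by simp [add_comm]
  rw [hcard, ncard_edgeSet_fan]
  rcases S.eq_empty_or_nonempty with rfl | hS
  · simpa using h
  · have hle := ncard_edgeSet_fan_inter_sym2_add_two_le hS
    have hcardS : S.card ≤ k + 4 := hcard ▸ S.card_le_univ
    calc (Fintype.card V : ℝ) ^ (k + 4 - S.card) *
          (p : ℝ) ^ (2 * (k + 3) - ((fan k).edgeSet ∩ S.sym2).ncard)
        ≤ (Fintype.card V : ℝ) ^ (k + 4 - S.card) * (p : ℝ) ^ (2 * (k + 4 - S.card)) := by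
          gcongr ?_ * ?_
          exact pow_le_pow_of_le_one hp p.2.2 (by omega)
      _ = (Fintype.card V * (p : ℝ) ^ 2) ^ (k + 4 - S.card) := by rw [mul_pow, pow_mul]
      _ ≤ 1 := pow_le_one₀ (by positivity) h2

theorem exp_neg_le_measureReal_not_hasDetour_fan (hp : (p : ℝ) ≤ 1 / 2)
    (hnp : 1 ≤ (Fintype.card V : ℝ) * p)
    (h : (Fintype.card V : ℝ) ^ (k + 4) * (p : ℝ) ^ (2 * (k + 3)) ≤ 1)
    (g : Fin 4 ⊕ Fin k ↪ V) :
    Real.exp (-(2 * (k + 4) ^ (k + 3))) ≤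
      G(V, p).real {G | ¬ HasDetour G (g '' {.inl 0}ᶜ) (Set.range g)} := by
  classical
  let X : Finset V := ({.inl 0}ᶜ : Finset (Fin 4 ⊕ Fin k)).map g
  have hX : (X : Set V) = g '' {.inl 0}ᶜ := by simp [X]
  have hcard : X.card = k + 3 := by
    rw [Finset.card_map, Finset.card_compl]
    simp
    omega
  have := exp_neg_le_measureReal_not_hasDetour (X := X) (Y := Set.range g) (p := p)
    (Finset.card_pos.1 (by omega)) (hX ▸ Set.image_subset_range _ _) hp hnp (by rwa [hcard])
  rw [hX, hcard] at this
  refine le_of_eq_of_le ?_ this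
  push_cast
  ring_nf

theorem le_measureReal_exists_isFanSet (hp : (p : ℝ) ≤ 1 / 2)
    (hn : 2 * (k + 4) ^ 2 ≤ Fintype.card V)
    (hnp : 1 ≤ (Fintype.card V : ℝ) * p) (h2 : (Fintype.card V : ℝ) * (p : ℝ) ^ 2 ≤ 1)
    (h : (Fintype.card V : ℝ) ^ (k + 4) * (p : ℝ) ^ (2 * (k + 3)) = 1) :
    (Real.exp (-(2 * (k + 4) ^ (k + 3))) / 2) ^ 2 / (2 * (k + 4)) ^ (k + 4) ≤
      G(V, p).real {G | ∃ X, IsFanSet G X ∧ ¬ IsCentered G X} := by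
  classical
  set c := Real.exp (-(2 * (k + 4) ^ (k + 3)))
  let copy (g : Fin 4 ⊕ Fin k ↪ V) : Set (SimpleGraph V) := {G | (fan k).map g ≤ G}
  let good (g : Fin 4 ⊕ Fin k ↪ V) : Set (SimpleGraph V) :=
    copy g ∩ {G | ¬ HasDetour G (g '' {.inl 0}ᶜ) (Set.range g)}
  have hcardW : Fintype.card (Fin 4 ⊕ Fin k) = k + 4 := by simp [add_comm]
  have hgood : ∀ g, (p : ℝ) ^ (2 * (k + 3)) * c ≤ G(V, p).real (good g) := fun g ↦ by
    have hind := indepSet_map_le_not_hasDetour (p := p) (fan k) g (g '' {.inl 0}ᶜ)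
    rw [measureReal_def, hind.measure_inter_eq_mul, ENNReal.toReal_mul, ← measureReal_def,
      ← measureReal_def, measureReal_map_le, ncard_edgeSet_fan]
    exact mul_le_mul_of_nonneg_left (exp_neg_le_measureReal_not_hasDetour_fan hp hnp h.le g)
      (pow_nonneg p.2.1 _)
  have hfirst : c / 2 ≤ ∑ g, G(V, p).real (good g) := by
    have hcard := half_pow_le_card_embedding (V := V) (W := Fin 4 ⊕ Fin k) (by rwa [hcardW])
    rw [hcardW] at hcard
    calc c / 2 = (Fintype.card V : ℝ) ^ (k + 4) / 2 * ((p : ℝ) ^ (2 * (k + 3)) * c) := by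
          linear_combination (-c / 2) * h
      _ ≤ Fintype.card (Fin 4 ⊕ Fin k ↪ V) * ((p : ℝ) ^ (2 * (k + 3)) * c) :=
          mul_le_mul_of_nonneg_right hcard (mul_nonneg (pow_nonneg p.2.1 _) (Real.exp_pos _).le)
      _ ≤ ∑ g, G(V, p).real (good g) := by
          rw [← nsmul_eq_mul]
          exact Finset.card_nsmul_le_sum _ _ _ fun g _ ↦ hgood g
  have hsecond : ∑ g, ∑ g', G(V, p).real (good g ∩ good g') ≤ (2 * (k + 4)) ^ (k + 4) := by
    have := sum_sum_measureReal_map_le_inter_le (card_pow_mul_pow_fan_le_one h2 h.le)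
    rw [hcardW] at this
    refine le_trans (Finset.sum_le_sum fun g _ ↦ Finset.sum_le_sum fun g' _ ↦ ?_)
      (this.trans_eq (by push_cast; rfl))
    exact measureReal_mono (Set.inter_subset_inter Set.inter_subset_left Set.inter_subset_left)
  refine (sq_div_le_measureReal_iUnion (fun _ ↦ .of_discrete) (by positivity) (by positivity)
    hfirst hsecond).trans (measureReal_mono (Set.iUnion_subset fun g G hG ↦ ?_))
  exact exists_isFanSet_not_isCentered_of_fan_map_le hG.1 hG.2

end LowerBound

section Connector

variable {V ι : Type*} {p : unitInterval} {v : V} {B : ι → Finset V} {C D : Finset V}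

/-- The vertex `v` has a neighbour in each of the sets `B i` and no neighbour in `C`. -/
def IsConnector (G : SimpleGraph V) (B : ι → Finset V) (C : Finset V) (v : V) : Prop :=
  (∀ i, ∃ w ∈ B i, G.Adj v w) ∧ ∀ w ∈ C, ¬ G.Adj v w

theorem dependsOnPairs_forall_not_adj (v : V) (C : Set V) :
    DependsOnPairs {G | ∀ w ∈ C, ¬ G.Adj v w} ((s(v, ·)) '' C) := by
  intro G H hGH hG w hw hvw
  exact hG w hw ((Set.ext_iff.1 hGH s(v, w)).2 ⟨hvw, w, hw, rfl⟩).1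

theorem dependsOnPairs_exists_adj (v : V) (C : Set V) :
    DependsOnPairs {G | ∃ w ∈ C, G.Adj v w} ((s(v, ·)) '' C) := by
  rintro G H hGH ⟨w, hw, hvw⟩
  exact ⟨w, hw, ((Set.ext_iff.1 hGH s(v, w)).1 ⟨hvw, w, hw, rfl⟩).1⟩

theorem dependsOnPairs_isConnector {R : Set V} (hB : ∀ i, (B i : Set V) ⊆ R) (hC : (C : Set V) ⊆ R)
    (v : V) : DependsOnPairs {G | IsConnector G B C v} ((s(v, ·)) '' R) :=
  fun _ _ hGH hG ↦
    ⟨fun i ↦ (dependsOnPairs_exists_adj v _).mono (Set.image_mono (hB i)) hGH (hG.1 i),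
      (dependsOnPairs_forall_not_adj v _).mono (Set.image_mono hC) hGH hG.2⟩

theorem half_le_one_sub_exp_neg {a : ℝ} (h0 : 0 ≤ a) (h1 : a ≤ 1) :
    a / 2 ≤ 1 - Real.exp (-a) := by
  have h := Real.add_one_le_exp a
  have h2 : Real.exp (-a) ≤ 1 / (a + 1) := by
    rw [Real.exp_neg, inv_eq_one_div]
    exact one_div_le_one_div_of_le (by linarith) h
  refine le_sub_comm.1 (h2.trans ?_)
  rw [div_le_iff₀ (by linarith)]
  nlinarith

variable [Finite V]

theorem half_le_measureReal_exists_adj {a : ℝ} {B : Finset V} (hv : v ∉ B) (ha0 : 0 ≤ a)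
    (ha1 : a ≤ 1) (haB : a ≤ (p : ℝ) * B.card) : a / 2 ≤ G(V, p).real {G | ∃ w ∈ B, G.Adj v w} := by
  have hcompl : {G : SimpleGraph V | ∃ w ∈ B, G.Adj v w} = {G | ∀ w ∈ B, ¬ G.Adj v w}ᶜ := by
    ext G
    simp
  rw [hcompl, probReal_compl_eq_one_sub .of_discrete, measureReal_forall_not_adj hv]
  calc a / 2 ≤ 1 - Real.exp (-a) := half_le_one_sub_exp_neg ha0 ha1
    _ ≤ 1 - Real.exp (-p) ^ B.card := by
      rw [← Real.exp_nat_mul]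
      gcongr
      linarith
    _ ≤ 1 - (1 - (p : ℝ)) ^ B.card := by
      gcongr
      · linarith [p.2.2]
      · exact Real.one_sub_le_exp_neg p

theorem half_le_measureReal_forall_not_adj (hv : v ∉ C) (hC : (p : ℝ) * C.card ≤ 1 / 2) :
    1 / 2 ≤ G(V, p).real {G | ∀ w ∈ C, ¬ G.Adj v w} := by
  rw [measureReal_forall_not_adj hv]
  have := one_add_mul_le_pow (a := -(p : ℝ)) (by linarith [p.2.2]) C.card
  rw [← sub_eq_add_neg] at this
  linarith

theorem le_measureReal_isConnector [Fintype ι] {a : ℝ} (hvB : ∀ i, v ∉ B i) (hvC : v ∉ C)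
    (hB : Pairwise (Function.onFun Disjoint B)) (hBC : ∀ i, Disjoint (B i) C) (ha0 : 0 ≤ a)
    (ha1 : a ≤ 1) (haB : ∀ i, a ≤ (p : ℝ) * (B i).card) (hC : (p : ℝ) * C.card ≤ 1 / 2) :
    (a / 2) ^ Fintype.card ι * (1 / 2) ≤ G(V, p).real {G | IsConnector G B C v} := by
  have hinj : Function.Injective (s(v, ·)) := fun _ _ ↦ Sym2.congr_right.1
  let meets (i : ι) : Set (SimpleGraph V) := {G | ∃ w ∈ B i, G.Adj v w}
  have hmeets : iIndepSet meets G(V, p) :=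
    iIndepSet_of_dependsOnPairs (fun i ↦ dependsOnPairs_exists_adj v (B i)) fun i j hij ↦
      (Set.disjoint_image_iff hinj).2 (Finset.disjoint_coe.2 (hB hij))
  have hind : IndepSet (⋂ i ∈ Finset.univ, meets i) {G | ∀ w ∈ C, ¬ G.Adj v w} G(V, p) :=
    DependsOnPairs.indepSet (A := (s(v, ·)) '' ⋃ i, (B i : Set V))
      (.biInter fun i _ ↦ (dependsOnPairs_exists_adj v (B i)).mono
        (Set.image_mono (Set.subset_iUnion (fun i ↦ (B i : Set V)) i)))
      (dependsOnPairs_forall_not_adj v C)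
      ((Set.disjoint_image_iff hinj).2 (Set.disjoint_iUnion_left.2 fun i ↦
        Finset.disjoint_coe.2 (hBC i)))
  have heq : {G | IsConnector G B C v} =
      (⋂ i ∈ Finset.univ, meets i) ∩ {G | ∀ w ∈ C, ¬ G.Adj v w} := by
    ext G
    simp [IsConnector, meets]
  rw [heq, measureReal_def, hind.measure_inter_eq_mul, ENNReal.toReal_mul, ← measureReal_def,
    ← measureReal_def, measureReal_biInter_of_iIndepSet hmeets]
  gcongr
  · rw [← Finset.card_univ, ← Finset.prod_const]
    exact Finset.prod_le_prod (fun _ _ ↦ by positivity) fun i _ ↦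
      half_le_measureReal_exists_adj (hvB i) ha0 ha1 (haB i)
  · exact half_le_measureReal_forall_not_adj hvC hC

theorem measureReal_forall_not_isConnector_le [Fintype ι] {a : ℝ}
    (hDB : ∀ i, Disjoint D (B i)) (hDC : Disjoint D C)
    (hB : Pairwise (Function.onFun Disjoint B)) (hBC : ∀ i, Disjoint (B i) C) (ha0 : 0 ≤ a)
    (ha1 : a ≤ 1) (haB : ∀ i, a ≤ (p : ℝ) * (B i).card) (hC : (p : ℝ) * C.card ≤ 1 / 2) :
    G(V, p).real {G | ∀ v ∈ D, ¬ IsConnector G B C v} ≤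
      Real.exp (-(D.card * ((a / 2) ^ Fintype.card ι * (1 / 2)))) := by
  let R : Set V := (⋃ i, (B i : Set V)) ∪ C
  have hDR : Disjoint (D : Set V) R := by
    simp only [R, Set.disjoint_union_right, Set.disjoint_iUnion_right, Finset.disjoint_coe]
    exact ⟨hDB, hDC⟩
  have hind : iIndepSet (fun v : D ↦ {G | IsConnector G B C v}ᶜ) G(V, p) := by
    refine iIndepSet_of_dependsOnPairs (A := fun v ↦ (s(v.1, ·)) '' R) (fun v ↦ ?_)
      fun v v' hvv' ↦ ?_
    · exact (dependsOnPairs_isConnector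
        (fun i ↦ (Set.subset_iUnion (fun i ↦ (B i : Set V)) i).trans Set.subset_union_left)
        Set.subset_union_right v.1).compl
    · rw [Function.onFun, Set.disjoint_left]
      rintro _ ⟨w, hw, rfl⟩ ⟨w', -, h⟩
      rcases Sym2.eq_iff.1 h with ⟨h, -⟩ | ⟨h, -⟩
      · exact hvv' (Subtype.ext h.symm)
      · exact Set.disjoint_left.1 hDR v'.2 (h ▸ hw)
  have hinter : {G | ∀ v ∈ D, ¬ IsConnector G B C v} =
      ⋂ v ∈ (Finset.univ : Finset D), {G | IsConnector G B C v}ᶜ := by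
    ext G
    simp
  rw [hinter, measureReal_biInter_of_iIndepSet hind, ← mul_neg, Real.exp_nat_mul]
  refine (Finset.prod_le_prod (fun _ _ ↦ measureReal_nonneg) fun v _ ↦ ?_).trans_eq
    (by rw [Finset.prod_const, Finset.card_univ, Fintype.card_coe])
  rw [probReal_compl_eq_one_sub .of_discrete]
  have hle := le_measureReal_isConnector (v := v.1)
    (fun i ↦ Finset.disjoint_left.1 (hDB i) v.2) (Finset.disjoint_left.1 hDC v.2) hB hBC ha0 ha1
    haB hC
  exact (sub_le_sub_left hle 1).trans (Real.one_sub_le_exp_neg _)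

end Connector

section Center

open scoped Classical in
/-- The vertices of `W` adjacent to `u` but not to `u'`. -/
noncomputable def privateNeighbors {V : Type*} (G : SimpleGraph V) (W : Finset V) (u u' : V) :
    Finset V :=
  {w ∈ W | G.Adj u w ∧ ¬ G.Adj u' w}

open scoped Classical in
/-- The vertices adjacent to every vertex of `X`. -/
noncomputable def dominators {V : Type*} [Fintype V] (G : SimpleGraph V) (X : Finset V) :
    Finset V :=
  {w | ∀ u ∈ X, G.Adj u w}

/-- The pairs of vertices outside `X`. -/
def pairsAvoiding {V : Type*} (X : Finset V) : Set (Sym2 V) :=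
  {e | ∀ v ∈ e, v ∉ X}

variable {V : Type*} {G : SimpleGraph V} {p : unitInterval} {X D W : Finset V} {u u' v w : V}

theorem mem_privateNeighbors :
    w ∈ privateNeighbors G W u u' ↔ w ∈ W ∧ G.Adj u w ∧ ¬ G.Adj u' w := by
  simp [privateNeighbors]

theorem privateNeighbors_subset : privateNeighbors G W u u' ⊆ W :=
  fun _ hw ↦ (mem_privateNeighbors.1 hw).1

theorem deleteEdges_pairsAvoiding_adj (hu : u ∈ X) :
    (G.deleteEdges (pairsAvoiding X)).Adj u w ↔ G.Adj u w := by
  simp [pairsAvoiding, hu]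

theorem privateNeighbors_deleteEdges_pairsAvoiding (hu : u ∈ X) (hu' : u' ∈ X) :
    privateNeighbors (G.deleteEdges (pairsAvoiding X)) W u u' = privateNeighbors G W u u' := by
  ext w
  simp only [mem_privateNeighbors, deleteEdges_pairsAvoiding_adj hu,
    deleteEdges_pairsAvoiding_adj hu']

theorem measureReal_adj_and_not_adj [Finite V] (hu : u ≠ w) (hu' : u' ≠ w) (huu' : u ≠ u') :
    G(V, p).real {G | G.Adj u w ∧ ¬ G.Adj u' w} = p * (1 - p) := by
  have hind : IndepSet {G : SimpleGraph V | s(u, w) ∈ G.edgeSet} {G | s(u', w) ∈ G.edgeSet}ᶜ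
      G(V, p) :=
    (dependsOnPairs_mem_edgeSet s(u, w)).indepSet (dependsOnPairs_mem_edgeSet s(u', w)).compl
      (Set.disjoint_singleton.2 fun h ↦ huu' (Sym2.congr_left.1 h))
  have hmul := congrArg ENNReal.toReal hind.measure_inter_eq_mul
  rwa [ENNReal.toReal_mul, ← measureReal_def, ← measureReal_def, ← measureReal_def,
    probReal_compl_eq_one_sub .of_discrete, measureReal_mem_edgeSet (by simpa using hu),
    measureReal_mem_edgeSet (by simpa using hu')] at hmul

theorem measureReal_card_privateNeighbors_le [Finite V] (hp : (p : ℝ) ≤ 1 / 2) (hu : u ∉ W)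
    (hu' : u' ∉ W) (huu' : u ≠ u') :
    G(V, p).real {G | ((privateNeighbors G W u u').card : ℝ) ≤ p * W.card / 8} ≤
      Real.exp (-(p * W.card / 8)) := by
  let S (w : W) : Set (SimpleGraph V) := {G | G.Adj u w ∧ ¬ G.Adj u' w}
  have hS : iIndepSet S G(V, p) := by
    refine iIndepSet_of_dependsOnPairs (A := fun w ↦ {s(u, w.1), s(u', w.1)})
      (fun w G H hGH hG ↦ ?_) fun w w' hww' ↦ ?_
    · exact ⟨(dependsOnPairs_mem_edgeSet s(u, w.1)).mono (by simp) hGH hG.1,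
        (dependsOnPairs_mem_edgeSet s(u', w.1)).compl.mono (by simp) hGH hG.2⟩
    · have hne : w.1 ≠ w'.1 := Subtype.coe_ne_coe.2 hww'
      simp only [Function.onFun, Set.disjoint_left]
      grind [w.2, w'.2]
  have hprob : ∀ w, (p : ℝ) / 2 ≤ G(V, p).real (S w) := fun w ↦ by
    rw [measureReal_adj_and_not_adj (ne_of_mem_of_not_mem w.2 hu).symm
      (ne_of_mem_of_not_mem w.2 hu').symm huu']
    nlinarith [p.2.1]
  have hcard : ∀ G : SimpleGraph V,
      (privateNeighbors G W u u').card = {w : W | G ∈ S w}.ncard := fun G ↦ by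
    rw [← Set.ncard_coe_finset, ← Set.ncard_image_of_injective _ Subtype.val_injective]
    congr 1
    ext w
    simp [mem_privateNeighbors, S, and_left_comm]
  have h := measureReal_ncard_le_le hS (fun _ ↦ .of_discrete) (by linarith [p.2.1]) hprob
  have hscale : (p : ℝ) * W.card / 8 = p / 2 * W.card / 4 := by ring
  simpa only [hcard, hscale, ← neg_div, Fintype.card_coe] using h

theorem isCentered_of_isConnector [Fintype V] {B : X → Finset V}
    (hB : ∀ u, ∀ w ∈ B u, w ∉ X ∧ G.Adj u w) (h : IsConnector G B (dominators G X) v) :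
    IsCentered G X := by
  refine ⟨v, fun u hu ↦ ?_, ?_⟩
  · obtain ⟨w, hw, hvw⟩ := h.1 ⟨u, hu⟩
    obtain ⟨hwX, huw⟩ := hB _ w hw
    exact ⟨w, hwX, huw.symm, hvw.symm⟩
  · rintro ⟨w, hwv, hw⟩
    exact h.2 w (by simpa [dominators] using fun u hu ↦ (hw u hu).symm) hwv.symm

variable [Fintype V]

theorem mem_dominators : w ∈ dominators G X ↔ ∀ u ∈ X, G.Adj u w := by
  simp [dominators]

theorem disjoint_dominators : Disjoint (dominators G X) X :=
  Finset.disjoint_left.2 fun _ hw hwX ↦ G.irrefl (mem_dominators.1 hw _ hwX)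

theorem disjoint_privateNeighbors_dominators (hu' : u' ∈ X) :
    Disjoint (privateNeighbors G W u u') (dominators G X) :=
  Finset.disjoint_left.2 fun _ hw hw' ↦
    (mem_privateNeighbors.1 hw).2.2 (mem_dominators.1 hw' u' hu')

theorem dominators_deleteEdges_pairsAvoiding :
    dominators (G.deleteEdges (pairsAvoiding X)) X = dominators G X := by
  ext w
  simp +contextual only [mem_dominators, deleteEdges_pairsAvoiding_adj]

theorem measureReal_le_card_dominators_le (hX : X.Nonempty) (ε : ℝ) :
    G(V, p).real {G | ε ≤ (dominators G X).card} ≤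
      Real.exp (2 * (p * Fintype.card V) - ε) := by
  obtain ⟨u, hu⟩ := hX
  have hprob : ∀ w, G(V, p).real {G | G.Adj u w} ≤ p := fun w ↦ by
    obtain rfl | huw := eq_or_ne u w
    · simpa using p.2.1
    · exact (measureReal_mem_edgeSet (e := s(u, w)) (by simpa using huw)).le
  refine (measureReal_mono fun G hG ↦ ?_).trans
    (measureReal_le_ncard_le (iIndepSet_adj u) (fun _ ↦ .of_discrete) hprob ε)
  refine le_trans (Set.mem_ofPred_eq ▸ hG) (Nat.cast_le.2 ?_)
  rw [← Set.ncard_coe_finset]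
  exact Set.ncard_le_ncard fun w hw ↦ mem_dominators.1 hw u hu

end Center

section Reservoirs

variable {V : Type*} [Fintype V] {p : unitInterval} {X D : Finset V} {L : ℕ}

theorem exists_pairwise_disjoint_card_eq {ι : Type*} [Fintype ι]
    (h : Fintype.card ι * L + X.card ≤ Fintype.card V) :
    ∃ W : ι → Finset V, (∀ i, Disjoint (W i) X) ∧ Pairwise (Function.onFun Disjoint W) ∧
      ∀ i, (W i).card = L := by
  classical
  obtain ⟨f⟩ : Nonempty (ι × Fin L ↪ (Xᶜ : Finset V)) := by
    refine Function.Embedding.nonempty_of_card_le ?_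
    rw [Fintype.card_prod, Fintype.card_fin, Fintype.card_coe, Finset.card_compl]
    omega
  have hf : Function.Injective fun x ↦ (f x : V) := Subtype.val_injective.comp f.injective
  refine ⟨fun i ↦ Finset.univ.image fun j ↦ (f (i, j) : V), fun i ↦ ?_, fun i i' hii' ↦ ?_,
    fun i ↦ ?_⟩
  · refine Finset.disjoint_left.2 fun w hw ↦ ?_
    obtain ⟨j, -, rfl⟩ := Finset.mem_image.1 hw
    exact Finset.mem_compl.1 (f (i, j)).2
  · refine Finset.disjoint_left.2 fun w hw hw' ↦ ?_
    obtain ⟨j, -, rfl⟩ := Finset.mem_image.1 hw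
    obtain ⟨j', -, h⟩ := Finset.mem_image.1 hw'
    exact hii' (congrArg Prod.fst (hf h)).symm
  · rw [Finset.card_image_of_injective _ fun j j' h ↦ congrArg Prod.snd (hf h),
      Finset.card_univ, Fintype.card_fin]

/-- Each `privateNeighbors G (W u) u (τ u)` and the set of dominators of `X` have about their
expected sizes in `G`. -/
def IsRegularAt (p : unitInterval) (G : SimpleGraph V) (W : X → Finset V) (τ : X → X) : Prop :=
  (∀ u, (p : ℝ) * (W u).card / 8 ≤ (privateNeighbors G (W u) u (τ u)).card) ∧
    (dominators G X).card ≤ 1 / (2 * (p : ℝ))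

variable {W : X → Finset V} {τ : X → X}

theorem measureReal_not_isRegularAt_le (hp : (p : ℝ) ≤ 1 / 2) (hX : X.Nonempty)
    (hWX : ∀ u, Disjoint (W u) X) (hWL : ∀ u, (W u).card = L) (hτ : ∀ u, τ u ≠ u) :
    G(V, p).real {G | ¬ IsRegularAt p G W τ} ≤ X.card * Real.exp (-(p * L / 8)) +
      Real.exp (2 * (p * Fintype.card V) - 1 / (2 * p)) := by
  have hprivate : ∀ u, G(V, p).real
      {G | ((privateNeighbors G (W u) u (τ u)).card : ℝ) ≤ p * (W u).card / 8} ≤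
        Real.exp (-(p * L / 8)) := fun u ↦ by
    simpa only [hWL] using measureReal_card_privateNeighbors_le hp
      (Finset.disjoint_right.1 (hWX u) u.2) (Finset.disjoint_right.1 (hWX u) (τ u).2)
      (Subtype.coe_ne_coe.2 (hτ u).symm)
  calc G(V, p).real {G | ¬ IsRegularAt p G W τ}
      ≤ G(V, p).real ((⋃ u, {G | ((privateNeighbors G (W u) u (τ u)).card : ℝ) ≤
          p * (W u).card / 8}) ∪ {G | 1 / (2 * (p : ℝ)) ≤ (dominators G X).card}) := by
        refine measureReal_mono fun G hG ↦ ?_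
        simp only [IsRegularAt, Set.mem_ofPred_eq, not_and_or, not_forall, not_le] at hG
        exact hG.imp (fun ⟨u, hu⟩ ↦ Set.mem_iUnion.2 ⟨u, hu.le⟩) le_of_lt
    _ ≤ _ := measureReal_union_le _ _
    _ ≤ _ := by
        gcongr
        · refine (measureReal_iUnion_fintype_le _).trans
            ((Finset.sum_le_sum fun u _ ↦ hprivate u).trans_eq ?_)
          rw [Finset.sum_const, Finset.card_univ, Fintype.card_coe, nsmul_eq_mul]
        · exact measureReal_le_card_dominators_le hX _

theorem isRegularAt_deleteEdges_pairsAvoiding {G : SimpleGraph V} :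
    IsRegularAt p (G.deleteEdges (pairsAvoiding X)) W τ ↔ IsRegularAt p G W τ := by
  simp only [IsRegularAt, dominators_deleteEdges_pairsAvoiding,
    privateNeighbors_deleteEdges_pairsAvoiding (Subtype.prop _) (Subtype.prop _)]

/-- Every vertex of `D` that is not a dominator of `X` in `H` fails to be a connector of the sets
`privateNeighbors H (W u) u (τ u)` avoiding the dominators of `X` in `H`, and `H` is regular.
Here `H` stands for the part of the graph that is exposed first. -/
def noConnectorEvent (p : unitInterval) (W : X → Finset V) (τ : X → X) (D : Finset V)
    (H : SimpleGraph V) : Set (SimpleGraph V) :=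
  {G | IsRegularAt p H W τ ∧ ∀ v ∈ D, v ∉ dominators H X →
    ¬ IsConnector G (fun u ↦ privateNeighbors H (W u) u (τ u)) (dominators H X) v}

theorem dependsOnPairs_noConnectorEvent (hWX : ∀ u, Disjoint (W u) X) (hDX : Disjoint D X)
    (H : SimpleGraph V) : DependsOnPairs (noConnectorEvent p W τ D H) (pairsAvoiding X) := by
  rintro G G' hGG' ⟨hH, hG⟩
  refine ⟨hH, fun v hv hvH ↦ ?_⟩
  refine (dependsOnPairs_isConnector (R := (X : Set V)ᶜ) (fun u w hw ↦ ?_) (fun w hw ↦ ?_)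
    v).compl.mono ?_ hGG' (hG v hv hvH)
  · exact Finset.disjoint_left.1 (hWX u) (privateNeighbors_subset hw)
  · exact Finset.disjoint_left.1 disjoint_dominators hw
  · rintro _ ⟨w, hw, rfl⟩
    simpa [pairsAvoiding] using ⟨Finset.disjoint_left.1 hDX hv, hw⟩

theorem measureReal_noConnectorEvent_le (hp0 : 0 < (p : ℝ))
    (hW : Pairwise (Function.onFun Disjoint W)) (hWL : ∀ u, (W u).card = L)
    (hDW : ∀ u, Disjoint D (W u)) (hDL : D.card = L) (hpL : 1 ≤ (p : ℝ) * L)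
    (ha : (p : ℝ) * (p * L / 8) ≤ 1) (H : SimpleGraph V) :
    G(V, p).real (noConnectorEvent p W τ D H) ≤
      Real.exp (-(L / 2 * ((p * (p * L / 8) / 2) ^ X.card * (1 / 2)))) := by
  classical
  by_cases hH : IsRegularAt p H W τ
  swap
  · simpa [noConnectorEvent, hH] using Real.exp_nonneg _
  obtain ⟨hprivate, hdom⟩ := hH
  have hdom' : (dominators H X).card ≤ (L : ℝ) / 2 := by
    refine hdom.trans ((div_le_iff₀ (by positivity)).2 ?_)
    linarith
  have hcard : (L : ℝ) / 2 ≤ (D \ dominators H X).card := by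
    have := Finset.le_card_sdiff (dominators H X) D
    have : (L : ℝ) ≤ (D \ dominators H X).card + (dominators H X).card := by
      exact_mod_cast (by omega)
    linarith
  have key := measureReal_forall_not_isConnector_le (p := p) (D := D \ dominators H X)
    (B := fun u ↦ privateNeighbors H (W u) u (τ u)) (C := dominators H X)
    (a := p * (p * L / 8))
    (fun u ↦ (hDW u).mono Finset.sdiff_subset privateNeighbors_subset) Finset.sdiff_disjoint
    (fun u u' huu' ↦ (hW huu').mono privateNeighbors_subset privateNeighbors_subset)
    (fun u ↦ disjoint_privateNeighbors_dominators (τ u).2) (by positivity) ha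
    (fun u ↦ mul_le_mul_of_nonneg_left (by simpa only [hWL] using hprivate u) hp0.le)
    (by rw [le_div_iff₀ (by positivity)] at hdom; linarith)
  rw [Fintype.card_coe] at key
  refine (measureReal_mono fun G hG ↦ ?_).trans (key.trans ?_)
  · exact fun v hv ↦ hG.2 v (Finset.mem_sdiff.1 hv).1 (Finset.mem_sdiff.1 hv).2
  · gcongr

theorem measureReal_not_isCentered_le (hp0 : 0 < (p : ℝ)) (hp : (p : ℝ) ≤ 1 / 2)
    (hX : 1 < X.card) (hL : (X.card + 1) * L + X.card ≤ Fintype.card V) (hpL : 1 ≤ (p : ℝ) * L)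
    (ha : (p : ℝ) * (p * L / 8) ≤ 1) :
    G(V, p).real {G | ¬ IsCentered G X} ≤ X.card * Real.exp (-(p * L / 8)) +
      Real.exp (2 * (p * Fintype.card V) - 1 / (2 * p)) +
      Real.exp (-(L / 2 * ((p * (p * L / 8) / 2) ^ X.card * (1 / 2)))) := by
  obtain ⟨W, hWX, hW, hWL⟩ := exists_pairwise_disjoint_card_eq (ι := Option X) (X := X) (L := L)
    (by simpa [Fintype.card_option] using hL)
  have : Nontrivial X := Finset.one_lt_card_iff_nontrivial.1 hX |>.coe_sort
  choose τ hτ using fun u : X ↦ exists_ne u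
  calc G(V, p).real {G | ¬ IsCentered G X}
      ≤ G(V, p).real ({G | ¬ IsRegularAt p G (W ∘ some) τ} ∪ {G |
          G ∈ noConnectorEvent p (W ∘ some) τ (W none) (G.deleteEdges (pairsAvoiding X))}) := by
        refine measureReal_mono fun G hG ↦ or_iff_not_imp_left.2 fun hreg ↦ ?_
        refine ⟨isRegularAt_deleteEdges_pairsAvoiding.2 (not_not.1 hreg), fun v _ _ hv ↦ hG ?_⟩
        simp only [dominators_deleteEdges_pairsAvoiding,
          privateNeighbors_deleteEdges_pairsAvoiding (Subtype.prop _) (Subtype.prop _)] at hv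
        refine isCentered_of_isConnector (fun u w hw ↦ ?_) hv
        obtain ⟨hwW, huw, -⟩ := mem_privateNeighbors.1 hw
        exact ⟨Finset.disjoint_left.1 (hWX _) hwW, huw⟩
    _ ≤ _ := measureReal_union_le _ _
    _ ≤ _ := by
        gcongr
        · exact measureReal_not_isRegularAt_le hp (Finset.card_pos.1 (by omega))
            (fun u ↦ hWX _) (fun u ↦ hWL _) hτ
        · exact measureReal_mem_deleteEdges_le
            (dependsOnPairs_noConnectorEvent (fun u ↦ hWX _) (hWX none))
            (measureReal_noConnectorEvent_le hp0
              (hW.comp_of_injective (Option.some_injective _)) (fun u ↦ hWL _)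
              (fun u ↦ hW (by simp)) (hWL none) hpL ha)

end Reservoirs

section Estimates

variable {m : ℕ} {K L p z : ℝ}

theorem mul_pow_two_mul_add_two (hp : p * z ^ (m + 2) = 1) : p * z ^ (2 * m + 2) = z ^ m := by
  rw [show 2 * m + 2 = m + 2 + m by ring, pow_add, ← mul_assoc, hp, one_mul]

theorem mul_mul_pow_mul_sq (hp : p * z ^ (m + 2) = 1) :
    p * (p * z ^ (2 * m + 2)) * z ^ 2 = 1 := by
  rw [mul_pow_two_mul_add_two hp, mul_assoc, ← pow_add, hp]

theorem le_mul_of_pow_le (hm : 2 ≤ m) (hK : 1 ≤ K) (hKz : K ≤ z) (hp0 : 0 < p)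
    (hp : p * z ^ (m + 2) = 1) (hL : z ^ (2 * m + 2) ≤ K * L) : z ≤ p * L := by
  refine le_of_mul_le_mul_left ?_ (zero_lt_one.trans_le hK)
  calc K * z ≤ z ^ 2 := by nlinarith
    _ ≤ z ^ m := pow_le_pow_right₀ (hK.trans hKz) hm
    _ = p * z ^ (2 * m + 2) := (mul_pow_two_mul_add_two hp).symm
    _ ≤ p * (K * L) := by gcongr
    _ = K * (p * L) := by ring

theorem two_mul_sub_one_div_le (hm : 1 ≤ m) (hz : 3 ≤ z) (hp0 : 0 < p)
    (hp : p * z ^ (m + 2) = 1) : 2 * (p * z ^ (2 * m + 2)) - 1 / (2 * p) ≤ -z := by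
  have hinv : 1 / (2 * p) = z ^ m * z ^ 2 / 2 := by
    rw [← pow_add, ← hp]
    field_simp
  have hzm : z ≤ z ^ m := le_self_pow₀ (by linarith) (by omega)
  rw [mul_pow_two_mul_add_two hp, hinv]
  nlinarith [mul_nonneg (by positivity : 0 ≤ z ^ m) (by nlinarith : 0 ≤ z ^ 2 - 9)]

theorem mul_mul_div_le_one (hz : 1 ≤ z) (hp0 : 0 ≤ p) (hp : p * z ^ (m + 2) = 1) (hL0 : 0 ≤ L)
    (hL : L ≤ z ^ (2 * m + 2)) : p * (p * L / 8) ≤ 1 :=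
  calc p * (p * L / 8) ≤ p * (p * L) * 1 := by
        rw [mul_one]
        gcongr
        exact div_le_self (by positivity) (by norm_num)
    _ ≤ p * (p * z ^ (2 * m + 2)) * z ^ 2 := by
        gcongr
        exact one_le_pow₀ hz
    _ = 1 := mul_mul_pow_mul_sq hp

theorem div_pow_le_mul_pow {j : ℕ} (hj : j ≤ m) (hK : 1 ≤ K) (hz : 1 ≤ z)
    (hp : p * z ^ (m + 2) = 1) (hL : z ^ (2 * m + 2) ≤ K * L) (ha : p * (p * L / 8) ≤ 1) :
    z / (16 * K) ^ (m + 1) ≤ L / 2 * ((p * (p * L / 8) / 2) ^ j * (1 / 2)) := by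
  have hLK : z ^ (2 * m + 2) / K ≤ L := (div_le_iff₀' (by linarith)).2 hL
  have hap : 1 / (16 * K * z ^ 2) ≤ p * (p * L / 8) / 2 := by
    rw [div_le_iff₀ (by positivity)]
    calc 1 = p ^ 2 * z ^ (2 * m + 2) * z ^ 2 := by rw [← mul_mul_pow_mul_sq hp]; ring
      _ ≤ p ^ 2 * (K * L) * z ^ 2 := by gcongr
      _ = p * (p * L / 8) / 2 * (16 * K * z ^ 2) := by ring
  have hapos : 0 ≤ p * (p * L / 8) / 2 := le_trans (by positivity) hap
  have hLpos : 0 ≤ L := le_trans (by positivity) hLK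
  calc z / (16 * K) ^ (m + 1) ≤ 4 * z ^ 2 / (16 * K) ^ (m + 1) := by
        gcongr
        nlinarith
    _ = z ^ (2 * m + 2) / K / 2 * ((1 / (16 * K * z ^ 2)) ^ m * (1 / 2)) := by
        rw [div_pow, mul_pow _ (z ^ 2), pow_add z, pow_mul z, pow_succ (16 * K)]
        field_simp
        norm_num
    _ ≤ L / 2 * ((p * (p * L / 8) / 2) ^ m * (1 / 2)) := by gcongr
    _ ≤ L / 2 * ((p * (p * L / 8) / 2) ^ j * (1 / 2)) := by
        gcongr ?_ * (?_ * _)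
        exact pow_le_pow_of_le_one hapos (by linarith) hj

theorem pow_pow_mul_pow_eq_one {k : ℕ} (hp : p * z ^ (k + 2 + 2) = 1) :
    (z ^ (2 * (k + 2) + 2)) ^ (k + 4) * p ^ (2 * (k + 3)) = 1 := by
  rw [← pow_mul, show (2 * (k + 2) + 2) * (k + 4) = (k + 2 + 2) * (2 * (k + 3)) by ring, pow_mul,
    ← mul_pow, mul_comm, hp, one_pow]

theorem exists_add_le_and_le_mul {n : ℕ} (hn : 4 * (m + 1) ≤ n) :
    ∃ L, (m + 1) * L + m ≤ n ∧ n ≤ 4 * (m + 1) * L := by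
  have hd : 0 < 2 * (m + 1) := by omega
  have hle := Nat.mul_div_le n (2 * (m + 1))
  have hlt := Nat.lt_mul_div_succ n hd
  have : 1 ≤ n / (2 * (m + 1)) := (Nat.one_le_div_iff hd).2 (by omega)
  exact ⟨n / (2 * (m + 1)), by nlinarith, by nlinarith⟩

end Estimates

section Bounds

variable {V : Type*} {p : unitInterval} {X : Finset V} {m k : ℕ} {z : ℝ}

theorem exists_fin_image_eq [DecidableEq V] (hX : X.Nonempty) (hXm : X.card ≤ m) :
    ∃ f : Fin m → V, Finset.univ.image f = X := by
  have : Nonempty X := hX.coe_sort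
  obtain ⟨g⟩ : Nonempty (X ↪ Fin m) := Function.Embedding.nonempty_of_card_le (by simpa)
  refine ⟨fun i ↦ (Function.invFun g i : X), ?_⟩
  rw [← Function.comp_def, ← Finset.image_image,
    Finset.image_univ_of_surjective (Function.invFun_surjective g.injective),
    Finset.univ_eq_attach, Finset.attach_image_val]

variable [Fintype V]

theorem measureReal_not_isCentered_le_exp (hm : 2 ≤ m) (hz : 4 * ((m : ℝ) + 1) ≤ z)
    (hV : (Fintype.card V : ℝ) = z ^ (2 * m + 2)) (hp : (p : ℝ) * z ^ (m + 2) = 1)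
    (hX : 1 < X.card) (hXm : X.card ≤ m) :
    G(V, p).real {G | ¬ IsCentered G X} ≤
      (m + 2) * Real.exp (-(z / (64 * ((m : ℝ) + 1)) ^ (m + 1))) := by
  have hm' : (2 : ℝ) ≤ m := by exact_mod_cast hm
  have hz1 : 1 ≤ z := by linarith
  have hp0 : 0 < (p : ℝ) := pos_of_mul_pos_left (hp ▸ zero_lt_one) (by positivity)
  have hp2 : (p : ℝ) ≤ 1 / 2 := by
    have : z ≤ z ^ (m + 2) := le_self_pow₀ hz1 (by omega)
    nlinarith
  obtain ⟨L, hLV, hVL⟩ : ∃ L, (m + 1) * L + m ≤ Fintype.card V ∧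
      Fintype.card V ≤ 4 * (m + 1) * L := by
    refine exists_add_le_and_le_mul ?_
    have : z ≤ z ^ (2 * m + 2) := le_self_pow₀ hz1 (by omega)
    exact_mod_cast (hz.trans this).trans_eq hV.symm
  have hLz : (L : ℝ) ≤ z ^ (2 * m + 2) := by
    rw [← hV]
    exact_mod_cast (by nlinarith : L ≤ Fintype.card V)
  have hzL : z ^ (2 * m + 2) ≤ 4 * ((m : ℝ) + 1) * L := by
    rw [← hV]
    exact_mod_cast hVL
  have ha := mul_mul_div_le_one hz1 hp0.le hp L.cast_nonneg hLz
  have hpL := le_mul_of_pow_le hm (by linarith) hz hp0 hp hzL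
  have hpowers := div_pow_le_mul_pow hXm (by linarith) hz1 hp hzL ha
  have hdegree := two_mul_sub_one_div_le (by omega) (by linarith) hp0 hp
  rw [← mul_assoc, show (16 * 4 : ℝ) = 64 by norm_num] at hpowers
  have hdecay : z / (64 * ((m : ℝ) + 1)) ^ (m + 1) ≤ z / 8 := by
    gcongr
    exact (by linarith : 8 ≤ 64 * ((m : ℝ) + 1)).trans (le_self_pow₀ (by linarith) (by omega))
  refine (measureReal_not_isCentered_le hp0 hp2 hX
    ((add_le_add (Nat.mul_le_mul_right L (by omega)) hXm).trans hLV) (hz1.trans hpL) ha).trans ?_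
  rw [hV]
  generalize z / (64 * ((m : ℝ) + 1)) ^ (m + 1) = c at *
  calc _ ≤ m * Real.exp (-c) + Real.exp (-c) + Real.exp (-c) := by gcongr <;> linarith
    _ = (m + 2) * Real.exp (-c) := by ring

theorem measureReal_exists_not_isCentered_le (hm : 2 ≤ m) (hz : 4 * ((m : ℝ) + 1) ≤ z)
    (hV : (Fintype.card V : ℝ) = z ^ (2 * m + 2)) (hp : (p : ℝ) * z ^ (m + 2) = 1) :
    G(V, p).real {G | ∃ X : Finset V, 1 < X.card ∧ X.card ≤ m ∧ ¬ IsCentered G X} ≤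
      z ^ ((2 * m + 2) * m) *
        ((m + 2) * Real.exp (-(z / (64 * ((m : ℝ) + 1)) ^ (m + 1)))) := by
  classical
  let bad (f : Fin m → V) : Set (SimpleGraph V) :=
    {G | 1 < (Finset.univ.image f).card ∧ ¬ IsCentered G (Finset.univ.image f : Finset V)}
  have hbad : ∀ f, G(V, p).real (bad f) ≤
      (m + 2) * Real.exp (-(z / (64 * ((m : ℝ) + 1)) ^ (m + 1))) := fun f ↦ by
    by_cases hf : 1 < (Finset.univ.image f).card
    · simpa only [bad, hf, true_and] using measureReal_not_isCentered_le_exp hm hz hV hp hf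
        (Finset.card_image_le.trans (by simp))
    · simp only [bad, hf, false_and, Set.ofPred_false, measureReal_empty]
      positivity
  calc _ ≤ G(V, p).real (⋃ f, bad f) := by
        refine measureReal_mono fun G ⟨X, hX, hXm, hG⟩ ↦ ?_
        obtain ⟨f, rfl⟩ := exists_fin_image_eq (Finset.card_pos.1 (by omega)) hXm
        exact Set.mem_iUnion.2 ⟨f, hX, hG⟩
    _ ≤ ∑ f, G(V, p).real (bad f) := measureReal_iUnion_fintype_le _
    _ ≤ ∑ f : Fin m → V, (m + 2) * Real.exp (-(z / (64 * ((m : ℝ) + 1)) ^ (m + 1))) :=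
        Finset.sum_le_sum fun f _ ↦ hbad f
    _ = _ := by simp [pow_mul, hV]

theorem measureReal_exists_isFanSet_le (hz : 4 * ((k : ℝ) + 3) ≤ z)
    (hV : (Fintype.card V : ℝ) = z ^ (2 * (k + 2) + 2)) (hp : (p : ℝ) * z ^ (k + 2 + 2) = 1) :
    G(V, p).real {G | ∃ X, IsFanSet G X ∧ ¬ IsCentered G X} ≤
      z ^ ((2 * (k + 2) + 2) * (k + 2)) *
        ((k + 4) * Real.exp (-(z / (64 * ((k : ℝ) + 3)) ^ (k + 3)))) + 1 / 2 := by
  have hsmall : G(V, p).real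
      {G | ∃ X : Finset V, 1 < X.card ∧ X.card ≤ k + 2 ∧ ¬ IsCentered G X} ≤ _ :=
    measureReal_exists_not_isCentered_le (by omega) (by push_cast; linarith) hV hp
  have hcopy : G(V, p).real {G | fan k ⊑ G} ≤ 1 / 2 := by
    have h := measureReal_isContained_le (V := V) (p := p) (fanSwapHubs k)
      ⟨.inl 0, by simp [fanSwapHubs]⟩
    rwa [ncard_edgeSet_fan, Fintype.card_sum, Fintype.card_fin, Fintype.card_fin, add_comm 4,
      hV, pow_pow_mul_pow_eq_one hp] at h
  calc G(V, p).real {G | ∃ X, IsFanSet G X ∧ ¬ IsCentered G X}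
      ≤ G(V, p).real ({G | ∃ X : Finset V, 1 < X.card ∧ X.card ≤ k + 2 ∧ ¬ IsCentered G X} ∪
          {G | fan k ⊑ G}) := by
        refine measureReal_mono fun G ⟨X, hX, hXc⟩ ↦ ?_
        obtain ⟨Y, rfl⟩ := X.toFinite.exists_finset_coe
        have hcard := hX.one_lt_ncard
        rw [Set.ncard_coe_finset] at hcard
        refine (le_or_gt Y.card (k + 2)).imp (fun hY ↦ ⟨Y, hcard, hY, hXc⟩) fun hY ↦ ?_
        exact hX.fan_isContained (by rwa [Set.ncard_coe_finset])
    _ ≤ _ := measureReal_union_le _ _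
    _ ≤ _ := add_le_add hsmall hcopy
    _ = _ := by push_cast; ring_nf

theorem le_measureReal_exists_isFanSet_of_pow (hz : 4 * ((k : ℝ) + 3) ≤ z)
    (hV : (Fintype.card V : ℝ) = z ^ (2 * (k + 2) + 2)) (hp : (p : ℝ) * z ^ (k + 2 + 2) = 1) :
    (Real.exp (-(2 * (k + 4) ^ (k + 3))) / 2) ^ 2 / (2 * (k + 4)) ^ (k + 4) ≤
      G(V, p).real {G | ∃ X, IsFanSet G X ∧ ¬ IsCentered G X} := by
  have hz1 : 1 ≤ z := by linarith [(Nat.cast_nonneg k : (0 : ℝ) ≤ k)]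
  have hp0 : 0 < (p : ℝ) := pos_of_mul_pos_left (hp ▸ zero_lt_one) (by positivity)
  refine le_measureReal_exists_isFanSet ?_ ?_ ?_ ?_ (hV ▸ pow_pow_mul_pow_eq_one hp)
  · have : z ≤ z ^ (k + 2 + 2) := le_self_pow₀ hz1 (by omega)
    nlinarith
  · have : 2 * ((k : ℝ) + 4) ^ 2 ≤ Fintype.card V := by
      rw [hV]
      have : z ^ 2 ≤ z ^ (2 * (k + 2) + 2) := pow_le_pow_right₀ hz1 (by omega)
      nlinarith
    exact_mod_cast this
  · rw [mul_comm, hV, mul_pow_two_mul_add_two hp]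
    exact one_le_pow₀ hz1
  · have h := mul_mul_pow_mul_sq hp
    rw [← hV] at h
    calc (Fintype.card V : ℝ) * p ^ 2 = p * (p * Fintype.card V) * 1 := by ring
      _ ≤ p * (p * Fintype.card V) * z ^ 2 := by
          gcongr
          exact one_le_pow₀ hz1
      _ = 1 := h

end Bounds

section Spectrum

theorem mem_spectrum_of_eventually_le {φ : MSOSentence} {α c d : ℝ} (hα : 0 < α) (hc : 0 < c)
    (hd : d < 1) (hcφ : ∀ᶠ n in atTop, c ≤ φ.prob α n) (hφd : ∀ᶠ n in atTop, φ.prob α n ≤ d) :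
    α ∈ φ.spectrum := by
  refine ⟨hα, ?_⟩
  rintro (h | h)
  · exact (ge_of_tendsto h hcφ).not_gt hc
  · exact (le_of_tendsto h hφd).not_gt hd

theorem edgeProb_mul_rpow_pow (m : ℕ) {n : ℕ} (hn : 0 < n) :
    (edgeProb (1 / 2 + 1 / (2 * ((m : ℝ) + 1))) n : ℝ) *
      ((n : ℝ) ^ ((2 * m + 2 : ℕ) : ℝ)⁻¹) ^ (m + 2) = 1 := by
  have hn' : (0 : ℝ) < n := Nat.cast_pos.2 hn
  rw [coe_edgeProb (by positivity), ← Real.rpow_natCast (_ ^ _), ← Real.rpow_mul hn'.le,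
    ← Real.rpow_add hn']
  convert Real.rpow_zero _ using 2
  push_cast
  field_simp
  ring

theorem mem_spectrum_fanSentence {m : ℕ} (hm : 2 ≤ m) :
    1 / 2 + 1 / (2 * ((m : ℝ) + 1)) ∈ fanSentence.spectrum := by
  obtain ⟨k, rfl⟩ := Nat.exists_eq_add_of_le' hm
  let z (n : ℕ) : ℝ := (n : ℝ) ^ ((2 * (k + 2) + 2 : ℕ) : ℝ)⁻¹
  have hz : Tendsto z atTop atTop :=
    (tendsto_rpow_atTop (by positivity)).comp tendsto_natCast_atTop_atTop
  have hzn : ∀ n : ℕ, (Fintype.card (Fin n) : ℝ) = z n ^ (2 * (k + 2) + 2) := fun n ↦ by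
    rw [Fintype.card_fin, Real.rpow_inv_natCast_pow n.cast_nonneg (by omega)]
  have hlarge := hz.eventually_ge_atTop (4 * ((k : ℝ) + 3))
  have hupper : Tendsto (fun n ↦ z n ^ ((2 * (k + 2) + 2) * (k + 2)) *
      ((k + 4) * Real.exp (-(z n / (64 * ((k : ℝ) + 3)) ^ (k + 3)))) + 1 / 2) atTop
      (𝓝 (1 / 2)) := by
    have h := (tendsto_rpow_mul_exp_neg_mul_atTop_nhds_zero
      ((2 * (k + 2) + 2) * (k + 2) : ℕ) ((64 * ((k : ℝ) + 3)) ^ (k + 3))⁻¹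
      (by positivity)).comp hz
    have h' := (h.const_mul ((k : ℝ) + 4)).add_const (1 / 2)
    rw [mul_zero, zero_add] at h'
    refine h'.congr fun n ↦ ?_
    simp only [Function.comp, Real.rpow_natCast]
    ring_nf
  refine mem_spectrum_of_eventually_le (d := 3 / 4) (by positivity)
    (c := (Real.exp (-(2 * (k + 4) ^ (k + 3))) / 2) ^ 2 / (2 * (k + 4)) ^ (k + 4))
    (by positivity) (by norm_num) ?_ ?_
  · filter_upwards [hlarge, eventually_gt_atTop 0] with n hn hn0
    simpa only [MSOFormula.prob, models_fanSentence] using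
      le_measureReal_exists_isFanSet_of_pow hn (hzn n) (edgeProb_mul_rpow_pow (k + 2) hn0)
  · filter_upwards [hlarge, eventually_gt_atTop 0,
      hupper.eventually_le_const (by norm_num : (1 / 2 : ℝ) < 3 / 4)] with n hn hn0 hnupper
    simpa only [MSOFormula.prob, models_fanSentence] using
      (measureReal_exists_isFanSet_le hn (hzn n) (edgeProb_mul_rpow_pow (k + 2) hn0)).trans hnupper

end Spectrum

end RandomGraph

theorem theorem3 :
    ∃ φ : MSOSentence, φ.quantifierDepth = 4 ∧ φ.spectrum.Infinite ∧
      ∀ m : ℕ, 2 ≤ m → (1 / 2 + 1 / (2 * ((m : ℝ) + 1))) ∈ φ.spectrum := by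
  refine ⟨RandomGraph.fanSentence, RandomGraph.quantifierDepth_fanSentence, ?_,
    fun m hm ↦ RandomGraph.mem_spectrum_fanSentence hm⟩
  refine Set.infinite_of_injective_forall_mem
    (f := fun k : ℕ ↦ 1 / 2 + 1 / (2 * (((k + 2 : ℕ) : ℝ) + 1))) (fun a b hab ↦ ?_)
    fun k ↦ RandomGraph.mem_spectrum_fanSentence (by omega)
  simpa using hab
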